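/- **Setting.** Let $T\ge 1$, and let $Y_0,\dots,Y_T$ (outcomes), $X_1,\dots,X_T$ (regressors) and $A$ (latent heterogeneity) be random variables in measurable spaces, with densities taken with respect to fixed $\sigma$-finite reference measures, which carry the (known, common) support of each variable. Write $y^T=(y_0,\dots,y_T)$, $x^T=(x_1,\dots,x_T)$, $y^{s:t}=(y_s,\dots,y_t)$. For each $\theta\in\Theta$ let $f_\theta(y_t\mid y_{t-1},x_t,a)$, $t=1,\dots,T$, be known conditional densities (which may differ over $t$). The set $\Omega$ of nuisance parameters consists of all $\omega=(g,\pi,\nu)$, where $g$ collects the conditional densities $g(x_t\mid y^{t-1},x^{t-1},a)$, $t=2,\dots,T$, $\pi(a\mid y_0,x_1)$ is a conditional density and $\nu(y_0,x_1)$ is a density, all positive on the common support and otherwise unrestricted; $\Omega$ carries an arbitrary topology. Under $(\theta,\omega)$ the joint density of $(Y^T,X^T,A)$ is $$p_{\theta,\omega}(y^T,x^T,a)=\prod_{t=1}^T f_\theta(y_t\mid y_{t-1},x_t,a)\prod_{t=2}^T g(x_t\mid y^{t-1},x^{t-1},a)\;\pi(a\mid y_0,x_1)\,\nu(y_0,x_1),$$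 and the likelihood is $\ell(\theta,\omega\mid y^T,x^T)=\int p_{\theta,\omega}(y^T,x^T,a)\,\mathrm da$. Fix $\theta\in\Theta$ and let $\varphi_\theta(y^T,x^T)$ and $h_\theta(y^T,x^T,a)$ be measurable with values in $\mathbb R^L$. Put $\mu(\theta,\omega)=\mathbb E_{\theta,\omega}[h_\theta(Y^T,X^T,A)]$. Consider the $T$ restrictions (i) $\displaystyle\int(\varphi_\theta(y^T,x^T)-h_\theta(y^T,x^T,a))\prod_{t=1}^T f_\theta(y_t\mid y_{t-1},x_t,a)\,\mathrm dy^{1:T}=0$; (ii) for all $s=2,\dots,T$, $\displaystyle\int(\varphi_\theta(y^T,x^T)-h_\theta(y^T,x^T,a))\prod_{t=s}^T f_\theta(y_t\mid y_{t-1},x_t,a)\,\mathrm dy^{s:T}$ does not depend on $x^{s:T}$, i.e. it equals a measurable function of $(y^{s-1},x^{s-1},a)$. Here the integrals are iterated integrals ($y_T$ is integrated first) that are required to exist, and the restrictions are required for almost all values, with respect to the reference measures, of the remaining arguments $(y^{s-1},x^T,a)$ ($s=1$ in (i)) such that $f_\theta(y_t\mid y_{t-1},x_t,a)>0$ for all $t<s$.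 **Theorem.** (A) If (i) and (ii) hold, then for every $\omega\in\Omega$ such that $\mathbb E_{\theta,\omega}\|\varphi_\theta(Y^T,X^T)\|<\infty$ and $\mathbb E_{\theta,\omega}\|h_\theta(Y^T,X^T,A)\|<\infty$ we have $$\mathbb E_{\theta,\omega}[\varphi_\theta(Y^T,X^T)]=\mu(\theta,\omega).\qquad(*)$$ (B) Suppose that, for some $\omega^*\in\Omega$, (a) the root likelihood $\omega\mapsto\ell^{1/2}(\theta,\omega\mid y^T,x^T)$ is differentiable in quadratic mean at $\omega^*$, and (b) there is a neighborhood $\mathcal N$ of $\omega^*$ such that $\sup_{\omega\in\mathcal N}\mathbb E_{\theta,\omega}\|\varphi_\theta(Y^T,X^T)\|^2<\infty$ and $\sup_{\omega\in\mathcal N}\mathbb E_{\theta,\omega}\|h_\theta(Y^T,X^T,A)\|^2<\infty$. Then the converse is also true: if $(*)$ holds for every $\omega\in\Omega$ under which $\varphi_\theta$ and $h_\theta$ are absolutely integrable, then (i) and (ii) hold. In (B)(a), a curve $\eta\mapsto p_\eta$ of densities is differentiable in quadratic mean at $0$ if there is a score $S$ with $\int S^2p_0<\infty$ and $\int\big[(p_\eta^{1/2}-p_0^{1/2})/\eta-\tfrac12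 S\,p_0^{1/2}\big]^2\to0$ as $\eta\to0$; the root likelihood is differentiable in quadratic mean at $\omega^*$ if $\eta\mapsto\ell(\theta,\omega_\eta\mid\cdot)$ is so for each smooth path $\eta\mapsto\omega_\eta$ in $\Omega$ with $\omega_0=\omega^*$, that is, each path that is continuous at $0$ and for which $\eta\mapsto p_{\theta,\omega_\eta}$ is differentiable in quadratic mean at $0$. -/

import Mathlib

open MeasureTheory Filter Topology

noncomputable section

/-- Values `(y₀, …, y_T)` of the outcomes, for `T = n + 1` periods. -/
abbrev YPath (n : ℕ) (Y : Type*) := Fin (n + 2) → Y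

/-- Values `(x₁, …, x_T)` of the regressors, for `T = n + 1` periods: `x i` is `x_{i+1}`. -/
abbrev XPath (n : ℕ) (X : Type*) := Fin (n + 1) → X

/-- `(y₀, …, y_k)`, the first `k + 1` outcomes. -/
def yPast {n : ℕ} {Y : Type*} (k : ℕ) (hk : k < n + 2) (y : YPath n Y) : Fin (k + 1) → Y :=
  fun i => y ⟨i, by omega⟩

/-- `(x₁, …, x_k)`, the first `k` regressors. -/
def xPast {n : ℕ} {X : Type*} (k : ℕ) (hk : k < n + 2) (x : XPath n X) : Fin k → X :=
  fun i => x ⟨i, by omega⟩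

/-- The known part of a panel data model with `T = n + 1` periods: the reference measures with
respect to which densities are taken (they carry the common support of the variables), and the
parametric family of outcome densities. `f θ t y x a u` is the density `f_θ(u | y, x, a)` of
period `t + 1`, that is, of `Y_{t+1}` at `u` given `Y_t = y`, `X_{t+1} = x`, `A = a`. It may
differ across periods. -/
structure PanelModel (n : ℕ) (Θ Y X A : Type*)
    [MeasurableSpace Y] [MeasurableSpace X] [MeasurableSpace A] where
  refY : Fin (n + 2) → Measure Y
  refX : Fin (n + 1) → Measure X
  refA : Measure A
  sigmaFinite_refY : ∀ i, SigmaFinite (refY i)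
  sigmaFinite_refX : ∀ i, SigmaFinite (refX i)
  sigmaFinite_refA : SigmaFinite refA
  f : Θ → Fin (n + 1) → Y → X → A → Y → ℝ
  f_measurable : ∀ θ t, Measurable
    (fun q : Y × X × A × Y => f θ t q.1 q.2.1 q.2.2.1 q.2.2.2)
  f_nonneg : ∀ θ t y x a u, 0 ≤ f θ t y x a u
  f_lintegral : ∀ θ t y x a, ∫⁻ u, ENNReal.ofReal (f θ t y x a u) ∂(refY t.succ) = 1

namespace PanelModel

variable {n : ℕ} {Θ Y X A : Type*}
  [MeasurableSpace Y] [MeasurableSpace X] [MeasurableSpace A]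

instance (M : PanelModel n Θ Y X A) (i : Fin (n + 2)) : SigmaFinite (M.refY i) :=
  M.sigmaFinite_refY i

instance (M : PanelModel n Θ Y X A) (i : Fin (n + 1)) : SigmaFinite (M.refX i) :=
  M.sigmaFinite_refX i

instance (M : PanelModel n Θ Y X A) : SigmaFinite M.refA :=
  M.sigmaFinite_refA

/-- The nuisance parameter space `Ω`: all triples `ω = (g, π, ν)` of densities that are positive
on the common support and otherwise unrestricted.
`g t ys xs a u` is the feedback density of `X_{t+2}` at `u` given
`(Y₀, …, Y_{t+1}) = ys`, `(X₁, …, X_{t+1}) = xs`, `A = a`;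
`pi y x a` is the density of `A` at `a` given `Y₀ = y`, `X₁ = x`;
`nu` is the density of `(Y₀, X₁)`. -/
structure Nuisance (M : PanelModel n Θ Y X A) where
  g : (t : Fin n) → (Fin (t.val + 1 + 1) → Y) → (Fin (t.val + 1) → X) → A → X → ℝ
  pi : Y → X → A → ℝ
  nu : Y → X → ℝ
  g_measurable : ∀ t : Fin n, Measurable
    (fun q : (Fin (t.val + 1 + 1) → Y) × (Fin (t.val + 1) → X) × A × X =>
      g t q.1 q.2.1 q.2.2.1 q.2.2.2)
  pi_measurable : Measurable (fun q : Y × X × A => pi q.1 q.2.1 q.2.2)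
  nu_measurable : Measurable (fun q : Y × X => nu q.1 q.2)
  g_pos : ∀ t ys xs a u, 0 < g t ys xs a u
  pi_pos : ∀ y x a, 0 < pi y x a
  nu_pos : ∀ y x, 0 < nu y x
  g_lintegral : ∀ t ys xs a, ∫⁻ u, ENNReal.ofReal (g t ys xs a u) ∂(M.refX t.succ) = 1
  pi_lintegral : ∀ y x, ∫⁻ a, ENNReal.ofReal (pi y x a) ∂M.refA = 1
  nu_lintegral : ∫⁻ y, ∫⁻ x, ENNReal.ofReal (nu y x) ∂(M.refX 0) ∂(M.refY 0) = 1

/-- Reference measure for the observed data `(y^T, x^T)`. -/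
def refObs (M : PanelModel n Θ Y X A) : Measure (YPath n Y × XPath n X) :=
  (Measure.pi M.refY).prod (Measure.pi M.refX)

/-- Reference measure for the complete data `(y^T, x^T, a)`. -/
def refFull (M : PanelModel n Θ Y X A) : Measure ((YPath n Y × XPath n X) × A) :=
  M.refObs.prod M.refA

/-- The outcome density `f_θ(y_{t+1} | y_t, x_{t+1}, a)` along a path. -/
def fAt (M : PanelModel n Θ Y X A) (θ : Θ) (t : Fin (n + 1))
    (y : YPath n Y) (x : XPath n X) (a : A) : ℝ :=
  M.f θ t (y t.castSucc) (x t) a (y t.succ)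

/-- Joint density of the complete data `(y^T, x^T, a)` under `(θ, ω)`. -/
def fullDensity (M : PanelModel n Θ Y X A) (θ : Θ) (ω : M.Nuisance)
    (z : (YPath n Y × XPath n X) × A) : ℝ :=
  (∏ t : Fin (n + 1), M.fAt θ t z.1.1 z.1.2 z.2) *
  (∏ t : Fin n, ω.g t (yPast (t.val + 1) (by omega) z.1.1)
    (xPast (t.val + 1) (by omega) z.1.2) z.2 (z.1.2 t.succ)) *
  ω.pi (z.1.1 0) (z.1.2 0) z.2 * ω.nu (z.1.1 0) (z.1.2 0)

/-- The likelihood `ℓ(θ, ω | y^T, x^T)`: density of the observed data under `(θ, ω)`. -/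
def likelihood (M : PanelModel n Θ Y X A) (θ : Θ) (ω : M.Nuisance)
    (w : YPath n Y × XPath n X) : ℝ :=
  ∫ a, M.fullDensity θ ω (w, a) ∂M.refA

/-- Law of the complete data `(Y^T, X^T, A)` under `(θ, ω)`. -/
def law (M : PanelModel n Θ Y X A) (θ : Θ) (ω : M.Nuisance) :
    Measure ((YPath n Y × XPath n X) × A) :=
  M.refFull.withDensity (fun z => ENNReal.ofReal (M.fullDensity θ ω z))

/-- The average effect `μ(θ, ω) = E_{θ,ω}[h(Y^T, X^T, A)]`. -/
def avgEffect (M : PanelModel n Θ Y X A) {E : Type*} [NormedAddCommGroup E] [NormedSpace ℝ E]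
    (h : YPath n Y → XPath n X → A → E) (θ : Θ) (ω : M.Nuisance) : E :=
  ∫ z, h z.1.1 z.1.2 z.2 ∂(M.law θ ω)

/-- The integral of `F(y^T, x^T, a) ∏_{t > k} f_θ(y_t | y_{t-1}, x_t, a)` over
`y_{k+1}, …, y_T`, as an iterated integral (`y_T` first, `y_{k+1}` last) with
`x^T`, `a` and `y₀, …, y_k` fixed. The value does not depend on the coordinates
`y_{k+1}, …, y_T` of the argument. -/
def iterInt (M : PanelModel n Θ Y X A) (θ : Θ) {E : Type*} [NormedAddCommGroup E]
    [NormedSpace ℝ E] (F : YPath n Y → XPath n X → A → E) (k : Fin (n + 2)) :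
    YPath n Y → XPath n X → A → E :=
  Fin.reverseInduction (motive := fun _ => YPath n Y → XPath n X → A → E) F
    (fun t G y x a =>
      ∫ u, M.f θ t (y t.castSucc) (x t) a u • G (Function.update y t.succ u) x a
        ∂(M.refY t.succ)) k

/-- The history `(y₀, …, y_k)` has positive outcome density given `x₁, …, x_k` and `a`. -/
def Attainable (M : PanelModel n Θ Y X A) (θ : Θ) (k : ℕ)
    (y : YPath n Y) (x : XPath n X) (a : A) : Prop :=
  ∀ r : Fin (n + 1), r.val < k → 0 < M.fAt θ r y x a

/-- The `T` restrictions on a function `F(y^T, x^T, a)`, for almost all values in the support: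
the integrals exist; (i) the integral over `y^{1:T}` vanishes; (ii) for `s = t + 2 = 2, …, T`,
the integral over `y^{s:T}` is a function of `(y^{s-1}, x^{s-1}, a)` only. -/
structure Restrictions (M : PanelModel n Θ Y X A) (θ : Θ) {E : Type*} [NormedAddCommGroup E]
    [NormedSpace ℝ E] [MeasurableSpace E] (F : YPath n Y → XPath n X → A → E) : Prop where
  integrable : ∀ t : Fin (n + 1), ∀ᵐ z ∂M.refFull, M.Attainable θ t.val z.1.1 z.1.2 z.2 →
    Integrable (fun u => M.f θ t (z.1.1 t.castSucc) (z.1.2 t) z.2 u •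
      M.iterInt θ F t.succ (Function.update z.1.1 t.succ u) z.1.2 z.2) (M.refY t.succ)
  hetero : ∀ᵐ z ∂M.refFull, M.iterInt θ F 0 z.1.1 z.1.2 z.2 = 0
  feedback : ∀ t : Fin n, ∃ m : (Fin (t.val + 1 + 1) → Y) → (Fin (t.val + 1) → X) → A → E,
    Measurable (fun q : (Fin (t.val + 1 + 1) → Y) × (Fin (t.val + 1) → X) × A =>
      m q.1 q.2.1 q.2.2) ∧
    ∀ᵐ z ∂M.refFull, M.Attainable θ (t.val + 1) z.1.1 z.1.2 z.2 →
      M.iterInt θ F t.succ.castSucc z.1.1 z.1.2 z.2 =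
        m (yPast (t.val + 1) (by omega) z.1.1) (xPast (t.val + 1) (by omega) z.1.2) z.2

end PanelModel

/-- A curve `η ↦ p η` of densities is differentiable in quadratic mean at `η = 0`, with some
square-integrable score `S`. -/
def QMDCurve {Z : Type*} [MeasurableSpace Z] (κ : Measure Z) (p : ℝ → Z → ℝ) : Prop :=
  ∃ S : Z → ℝ, Measurable S ∧
    ∫⁻ z, ENNReal.ofReal (S z ^ 2 * p 0 z) ∂κ < ⊤ ∧
    Tendsto (fun η : ℝ => ∫⁻ z, ENNReal.ofReal
      (((√(p η z) - √(p 0 z)) / η - S z / 2 * √(p 0 z)) ^ 2) ∂κ) (𝓝[≠] 0) (𝓝 0)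

namespace PanelModel

variable {n : ℕ} {Θ Y X A : Type*}
  [MeasurableSpace Y] [MeasurableSpace X] [MeasurableSpace A]

/-- A smooth path (one-parameter submodel) `η ↦ ω_η` through `ωs` at `η = 0`: it is continuous at
`0`, and its complete-data densities have a square-integrable score at `0`. -/
def SmoothPath (M : PanelModel n Θ Y X A) [TopologicalSpace M.Nuisance] (θ : Θ)
    (ωs : M.Nuisance) (γ : ℝ → M.Nuisance) : Prop :=
  γ 0 = ωs ∧ ContinuousAt γ 0 ∧ QMDCurve M.refFull (fun η => M.fullDensity θ (γ η))

/-- The root likelihood `ω ↦ ℓ^{1/2}(θ, ω | ·)` is differentiable in quadratic mean at `ωs`,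
along smooth paths. -/
def RootLikelihoodQMD (M : PanelModel n Θ Y X A) [TopologicalSpace M.Nuisance] (θ : Θ)
    (ωs : M.Nuisance) : Prop :=
  ∀ γ : ℝ → M.Nuisance, M.SmoothPath θ ωs γ →
    QMDCurve M.refObs (fun η => M.likelihood θ (γ η))

end PanelModel

end

open scoped ENNReal

/-! Put F = φ − h; unbiasedness says that F has mean zero under the laws of the model. Such a law
arises by drawing (y_0, x_1, a) and then, alternately, an outcome from f and a regressor from g.
`stage j k` stops this construction after j outcomes and k feedback regressors and gives auxiliary
positive densities to the later coordinates, so that all stages live on one space. Consecutive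
stages differ by redrawing one coordinate (`isStep_outcome`, `isStep_feedback`): integrating over
the later stage means averaging over that coordinate and integrating over the earlier stage. By
`ae_stage_iff`, the null sets of `stage j k` are those of the reference measure on attainable
histories, whatever k and ω are. This is how almost-everywhere restrictions pass between stages.

Part (A) runs backwards through the stages. Averaging over an outcome produces the next iterated
integral. By (ii) it is a function of the past that excludes the newest regressor, and averaging it
over that regressor changes nothing because every g integrates to one. At the first period (i) makes
the integral vanish (`Restrictions.integral_eq_zero`).

Part (B) perturbs ω*. Multiplying one of g, π, ν by 1 + (b − E b)/4, where |b| ≤ 1 and E b is the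
mean of b under that density, gives another point of Ω whose density ratio is bounded, so
integrability persists. The mean of F is affine in each single factor, hence (*) at both points
makes F orthogonal to b − E b, without passing to a limit. Tilts of g show that the conditional mean
of F given a history and the newest regressor equals its average over that regressor, which is (ii);
tilts of π and ν show that the conditional mean given (y_0, x_1, a) is zero, which is (i). A
backward induction (`TiltOrthogonal.exists_isPastMean`) identifies these conditional means with the
iterated integrals: once a feedback average is known to be harmless, the next outcome can be
integrated out. -/

noncomputable section

/-! ### Densities and their bounded reweightings. -/

section Densities

variable {U : Type*} [MeasurableSpace U] {κ : Measure U}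

/-- On a σ-finite space there is a strictly positive function of finite integral; it only has to be
normalised. -/
lemma exists_pos_density [SigmaFinite κ] (h0 : κ ≠ 0) :
    ∃ w : U → ℝ, Measurable w ∧ (∀ u, 0 < w u) ∧ ∫⁻ u, ENNReal.ofReal (w u) ∂κ = 1 := by
  obtain ⟨g, hpos, hmeas, hlt⟩ := exists_pos_lintegral_lt_of_sigmaFinite κ one_ne_zero
  set c : ℝ≥0∞ := ∫⁻ u, g u ∂κ with hc
  have hc0 : c ≠ 0 := by
    intro h
    rw [hc, lintegral_eq_zero_iff hmeas.coe_nnreal_ennreal] at h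
    refine h0 (ae_eq_bot.1 (Filter.eventually_false_iff_eq_bot.1 ?_))
    filter_upwards [h] with u hu
    have := hpos u
    simp at hu
    exact this.ne' hu
  have hct : c ≠ ⊤ := (hlt.trans ENNReal.one_lt_top).ne
  refine ⟨fun u => g u / c.toReal, by fun_prop, fun u => ?_, ?_⟩
  · exact div_pos (hpos u) (ENNReal.toReal_pos hc0 hct)
  · have : ∀ u, ENNReal.ofReal (g u / c.toReal) = g u * c⁻¹ := fun u => by
      rw [ENNReal.ofReal_div_of_pos (ENNReal.toReal_pos hc0 hct), ENNReal.ofReal_toReal hct,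
        ENNReal.ofReal_coe_nnreal, div_eq_mul_inv]
    simp_rw [this]
    rw [lintegral_mul_const _ hmeas.coe_nnreal_ennreal, ENNReal.mul_inv_cancel hc0 hct]

/-- The density `d` reweighted by a function `b` with values in `[-1, 1]`. -/
def tiltDensity (κ : Measure U) (d b : U → ℝ) (u : U) : ℝ :=
  d u * (1 + (b u - ∫ v, d v * b v ∂κ) / 4)

variable {d b : U → ℝ}

lemma integrable_density (hd : Measurable d) (hd0 : ∀ u, 0 ≤ d u)
    (h1 : ∫⁻ u, ENNReal.ofReal (d u) ∂κ = 1) : Integrable d κ := by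
  refine ⟨hd.aestronglyMeasurable, ?_⟩
  rw [hasFiniteIntegral_iff_ofReal (ae_of_all _ hd0), h1]
  exact ENNReal.one_lt_top

lemma integral_density (hd : Measurable d) (hd0 : ∀ u, 0 ≤ d u)
    (h1 : ∫⁻ u, ENNReal.ofReal (d u) ∂κ = 1) : ∫ u, d u ∂κ = 1 := by
  rw [integral_eq_lintegral_of_nonneg_ae (ae_of_all _ hd0) hd.aestronglyMeasurable, h1,
    ENNReal.toReal_one]

lemma integrable_density_mul (hd : Measurable d) (hd0 : ∀ u, 0 ≤ d u)
    (h1 : ∫⁻ u, ENNReal.ofReal (d u) ∂κ = 1) (hb : Measurable b) (hb1 : ∀ u, |b u| ≤ 1) :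
    Integrable (fun u => d u * b u) κ :=
  (integrable_density hd hd0 h1).mul_bdd (c := 1) hb.aestronglyMeasurable (ae_of_all _ hb1)

lemma abs_integral_density_mul_le (hd : Measurable d) (hd0 : ∀ u, 0 ≤ d u)
    (h1 : ∫⁻ u, ENNReal.ofReal (d u) ∂κ = 1) (hb1 : ∀ u, |b u| ≤ 1) :
    |∫ u, d u * b u ∂κ| ≤ 1 := by
  rw [← integral_density hd hd0 h1, ← Real.norm_eq_abs]
  refine norm_integral_le_of_norm_le (integrable_density hd hd0 h1) (ae_of_all _ fun u => ?_)
  rw [norm_mul, Real.norm_of_nonneg (hd0 u)]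
  exact mul_le_of_le_one_right (hd0 u) (hb1 u)

/-- Both `b u` and its mean lie in [-1, 1], so their difference is at most 2 in absolute value;
division by 4 keeps the factor away from zero. -/
lemma tilt_factor_bounds (hd : Measurable d) (hd0 : ∀ u, 0 ≤ d u)
    (h1 : ∫⁻ u, ENNReal.ofReal (d u) ∂κ = 1) (hb1 : ∀ u, |b u| ≤ 1) (u : U) :
    0 < 1 + (b u - ∫ v, d v * b v ∂κ) / 4 ∧ 1 + (b u - ∫ v, d v * b v ∂κ) / 4 ≤ 2 := by
  have h := abs_le.1 (abs_integral_density_mul_le hd hd0 h1 hb1)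
  have h' := abs_le.1 (hb1 u)
  constructor <;> linarith [h.1, h.2, h'.1, h'.2]

lemma tiltDensity_pos (hd : Measurable d) (hd0 : ∀ u, 0 < d u)
    (h1 : ∫⁻ u, ENNReal.ofReal (d u) ∂κ = 1) (hb1 : ∀ u, |b u| ≤ 1) (u : U) :
    0 < tiltDensity κ d b u :=
  mul_pos (hd0 u) (tilt_factor_bounds hd (fun u => (hd0 u).le) h1 hb1 u).1

lemma lintegral_tiltDensity (hd : Measurable d) (hd0 : ∀ u, 0 < d u)
    (h1 : ∫⁻ u, ENNReal.ofReal (d u) ∂κ = 1) (hb : Measurable b) (hb1 : ∀ u, |b u| ≤ 1) :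
    ∫⁻ u, ENNReal.ofReal (tiltDensity κ d b u) ∂κ = 1 := by
  have hd0' : ∀ u, 0 ≤ d u := fun u => (hd0 u).le
  have hi := integrable_density hd hd0' h1
  have hib := integrable_density_mul hd hd0' h1 hb hb1
  have heq : ∀ u, tiltDensity κ d b u
      = d u * (1 - (∫ v, d v * b v ∂κ) / 4) + d u * b u * (1 / 4) := fun u => by
    simp only [tiltDensity]; ring
  rw [← ofReal_integral_eq_lintegral_ofReal]
  · simp_rw [heq]
    rw [integral_add (hi.mul_const _) (hib.mul_const _), integral_mul_const, integral_mul_const,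
      integral_density hd hd0' h1, ← ENNReal.ofReal_one]
    congr 1
    ring
  · exact ((hi.mul_const _).add (hib.mul_const _)).congr (ae_of_all _ fun u => (heq u).symm)
  · exact ae_of_all _ fun u => (tiltDensity_pos hd hd0 h1 hb1 u).le

end Densities

/-! ### Redrawing one coordinate. -/

section Steps

variable {Z U : Type*} [MeasurableSpace Z] [MeasurableSpace U]

/-- `Q` is obtained from `P` by redrawing a coordinate (through the map `T`) with density `q`. -/
structure IsStep (P Q : Measure Z) (κ : Measure U) (T : Z → U → Z) (q : Z → ℝ) : Prop where
  measurable_map : Measurable (fun p : Z × U => T p.1 p.2)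
  measurable_density : Measurable q
  nonneg : ∀ z, 0 ≤ q z
  lintegral_eq : ∀ H : Z → ℝ≥0∞, Measurable H →
    ∫⁻ z, H z ∂Q = ∫⁻ z, ∫⁻ u, ENNReal.ofReal (q (T z u)) * H (T z u) ∂κ ∂P

/-- The average of `H` over a redrawn coordinate. -/
def stepAvg {E : Type*} [NormedAddCommGroup E] [NormedSpace ℝ E] (κ : Measure U) (T : Z → U → Z)
    (q : Z → ℝ) (H : Z → E) (z : Z) : E :=
  ∫ u, q (T z u) • H (T z u) ∂κ

/-- The two densities share the factor `R`, which does not see the redrawn coordinate. They differ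
only in that the auxiliary `w` is replaced by `q`, and `swap` spends `w` on the old value of the
coordinate. -/
lemma IsStep.of_swap {μ : Measure Z} {κ : Measure U} [SFinite κ] {T : Z → U → Z}
    {w R q : Z → ℝ}
    (hT : Measurable (fun p : Z × U => T p.1 p.2)) (hw : Measurable w)
    (hR : Measurable R) (hq : Measurable q) (hR0 : ∀ z, 0 ≤ R z)
    (hq0 : ∀ z, 0 ≤ q z) (hRT : ∀ z u, R (T z u) = R z)
    (swap : ∀ H : Z → ℝ≥0∞, Measurable H →
      ∫⁻ z, H z ∂μ = ∫⁻ z, ENNReal.ofReal (w z) * ∫⁻ u, H (T z u) ∂κ ∂μ) :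
    IsStep (μ.withDensity fun z => ENNReal.ofReal (R z * w z))
      (μ.withDensity fun z => ENNReal.ofReal (R z * q z)) κ T q where
  measurable_map := hT
  measurable_density := hq
  nonneg := hq0
  lintegral_eq H hH := by
    have hTz : ∀ z, Measurable (T z) := fun z => hT.comp measurable_prodMk_left
    rw [lintegral_withDensity_eq_lintegral_mul _ (by fun_prop) hH,
      lintegral_withDensity_eq_lintegral_mul _ (by fun_prop)
        (Measurable.lintegral_prod_right'
          (f := fun p : Z × U => ENNReal.ofReal (q (T p.1 p.2)) * H (T p.1 p.2))
          (by fun_prop)), swap _ (by fun_prop)]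
    refine lintegral_congr fun z => ?_
    simp only [Pi.mul_apply, hRT, ENNReal.ofReal_mul (hR0 z), mul_assoc]
    rw [lintegral_const_mul _ (by have := hTz z; fun_prop)]
    ring

namespace IsStep

variable {P Q : Measure Z} {κ : Measure U} {T : Z → U → Z} {q : Z → ℝ} [SFinite P] [SFinite κ]

-- A step is a reweighted product followed by a pushforward, so Fubini for `P.prod κ` supplies the
-- Bochner versions of the defining identity.
omit [SFinite P] in
lemma eq_map (h : IsStep P Q κ T q) :
    Q = ((P.prod κ).withDensity fun p => ENNReal.ofReal (q (T p.1 p.2))).map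
      (fun p => T p.1 p.2) := by
  have hT := h.measurable_map
  have hq := h.measurable_density
  ext s hs
  have hm : Measurable (s.indicator (1 : Z → ℝ≥0∞)) := measurable_one.indicator hs
  rw [← lintegral_indicator_one hs, h.lintegral_eq _ hm, Measure.map_apply hT hs,
    ← lintegral_indicator_one (hT hs),
    lintegral_withDensity_eq_lintegral_mul _ (by fun_prop) (measurable_one.indicator (hT hs)),
    lintegral_prod _ (by
      exact ((by fun_prop : Measurable fun p : Z × U => ENNReal.ofReal (q (T p.1 p.2))).mul
        (measurable_one.indicator (hT hs))).aemeasurable)]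
  rfl

variable {E : Type*} [NormedAddCommGroup E] [NormedSpace ℝ E]

omit [SFinite P] in
lemma integrable_iff (h : IsStep P Q κ T q) {H : Z → E} (hH : StronglyMeasurable H) :
    Integrable H Q ↔ Integrable (fun p : Z × U => q (T p.1 p.2) • H (T p.1 p.2)) (P.prod κ) := by
  have hT := h.measurable_map
  have hq := h.measurable_density
  rw [h.eq_map, integrable_map_measure hH.aestronglyMeasurable hT.aemeasurable,
    integrable_withDensity_iff_integrable_smul' (by fun_prop)
      (ae_of_all _ fun _ => ENNReal.ofReal_lt_top)]
  simp only [ENNReal.toReal_ofReal (h.nonneg _), Function.comp_def]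

lemma ae_integrable (h : IsStep P Q κ T q) {H : Z → E} (hH : StronglyMeasurable H)
    (hi : Integrable H Q) : ∀ᵐ z ∂P, Integrable (fun u => q (T z u) • H (T z u)) κ :=
  ((h.integrable_iff hH).1 hi).prod_right_ae

omit [SFinite P] in
lemma integrable_avg (h : IsStep P Q κ T q) {H : Z → E} (hH : StronglyMeasurable H)
    (hi : Integrable H Q) : Integrable (stepAvg κ T q H) P :=
  ((h.integrable_iff hH).1 hi).integral_prod_left

lemma integral_avg (h : IsStep P Q κ T q) {H : Z → E} (hH : StronglyMeasurable H)
    (hi : Integrable H Q) : ∫ z, stepAvg κ T q H z ∂P = ∫ z, H z ∂Q := by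
  have hT := h.measurable_map
  have hq := h.measurable_density
  have := integral_prod _ ((h.integrable_iff hH).1 hi)
  rw [show ∫ z, stepAvg κ T q H z ∂P = _ from this.symm, h.eq_map,
    integral_map hT.aemeasurable hH.aestronglyMeasurable,
    integral_withDensity_eq_integral_toReal_smul (by fun_prop)
      (ae_of_all _ fun _ => ENNReal.ofReal_lt_top)]
  simp only [ENNReal.toReal_ofReal (h.nonneg _)]

omit [SFinite P] in
lemma stronglyMeasurable_avg (h : IsStep P Q κ T q) {H : Z → E} (hH : StronglyMeasurable H) :
    StronglyMeasurable (stepAvg κ T q H) := by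
  have hT := h.measurable_map
  have hq := h.measurable_density
  have h1 : StronglyMeasurable fun p : Z × U => q (T p.1 p.2) :=
    (hq.comp hT).stronglyMeasurable
  exact (h1.smul (hH.comp_measurable hT)).integral_prod_right

omit [SFinite P] in
lemma ae_ae (h : IsStep P Q κ T q) {S : Z → Prop} (hS : ∀ᵐ z ∂Q, S z) :
    ∀ᵐ z ∂P, ∀ᵐ u ∂κ, 0 < q (T z u) → S (T z u) := by
  have hT := h.measurable_map
  have hq := h.measurable_density
  rw [h.eq_map] at hS
  have h1 := ae_of_ae_map hT.aemeasurable hS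
  rw [ae_withDensity_iff (by fun_prop)] at h1
  filter_upwards [Measure.ae_ae_of_ae_prod h1] with z hz
  filter_upwards [hz] with u hu hpos
  exact hu (by simpa using hpos)

omit [SFinite P] in
lemma avg_congr (h : IsStep P Q κ T q) {H H' : Z → E} (hH : ∀ᵐ z ∂Q, H z = H' z) :
    ∀ᵐ z ∂P, (fun u => q (T z u) • H (T z u)) =ᵐ[κ] (fun u => q (T z u) • H' (T z u)) := by
  filter_upwards [h.ae_ae hH] with z hz
  filter_upwards [hz] with u hu
  -- Where `q` vanishes, `H` and `H'` may differ, but the weight removes both.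
  rcases (h.nonneg (T z u)).eq_or_lt with h0 | h0
  · simp [← h0]
  · simp only [hu h0]

-- A function that ignores the redrawn coordinate cannot tell `P` from `Q`, because the new density
-- has total mass one. For feedback steps this is why an unrestricted g drops out.
omit [SFinite P] [SFinite κ] in
lemma lintegral_eq_of_invariant (h : IsStep P Q κ T q)
    (h1 : ∀ z, ∫⁻ u, ENNReal.ofReal (q (T z u)) ∂κ = 1) {H : Z → ℝ≥0∞} (hH : Measurable H)
    (hinv : ∀ z u, H (T z u) = H z) : ∫⁻ z, H z ∂Q = ∫⁻ z, H z ∂P := by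
  have hT := h.measurable_map
  have hq := h.measurable_density
  rw [h.lintegral_eq H hH]
  refine lintegral_congr fun z => ?_
  have hTz : Measurable (T z) := hT.comp measurable_prodMk_left
  simp only [hinv]
  rw [lintegral_mul_const _ (by fun_prop), h1, one_mul]

omit [NormedSpace ℝ E] [SFinite P] [SFinite κ] in
lemma integrable_iff_of_invariant (h : IsStep P Q κ T q)
    (h1 : ∀ z, ∫⁻ u, ENNReal.ofReal (q (T z u)) ∂κ = 1) {H : Z → E} (hH : StronglyMeasurable H)
    (hinv : ∀ z u, H (T z u) = H z) : Integrable H Q ↔ Integrable H P := by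
  simp only [Integrable, hH.aestronglyMeasurable, true_and, HasFiniteIntegral]
  rw [h.lintegral_eq_of_invariant h1 hH.enorm (fun z u => by rw [hinv])]

variable [CompleteSpace E]

omit [SFinite P] [SFinite κ] in
lemma avg_of_invariant (h : IsStep P Q κ T q)
    (h1 : ∀ z, ∫⁻ u, ENNReal.ofReal (q (T z u)) ∂κ = 1) {H : Z → E}
    (hinv : ∀ z u, H (T z u) = H z) : stepAvg κ T q H = H := by
  have hT := h.measurable_map
  have hq := h.measurable_density
  ext z
  have hTz : Measurable (T z) := hT.comp measurable_prodMk_left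
  simp only [stepAvg, hinv]
  rw [integral_smul_const, integral_density (by fun_prop) (fun u => h.nonneg _) (h1 z), one_smul]

lemma integral_eq_of_invariant (h : IsStep P Q κ T q)
    (h1 : ∀ z, ∫⁻ u, ENNReal.ofReal (q (T z u)) ∂κ = 1) {H : Z → E} (hH : StronglyMeasurable H)
    (hi : Integrable H P) (hinv : ∀ z u, H (T z u) = H z) : ∫ z, H z ∂Q = ∫ z, H z ∂P := by
  rw [← h.integral_avg hH ((h.integrable_iff_of_invariant h1 hH hinv).2 hi),
    h.avg_of_invariant h1 hinv]

end IsStep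

end Steps

/-! ### Resampling a coordinate of a product measure. -/

section PiSwap

variable {ι : Type*} [Fintype ι] [DecidableEq ι] {α : ι → Type*} [∀ i, MeasurableSpace (α i)]
  (μ : ∀ i, Measure (α i)) [∀ i, SigmaFinite (μ i)]

lemma lintegral_pi_swap (i : ι) {w : α i → ℝ≥0∞} (hw : Measurable w) (h1 : ∫⁻ u, w u ∂μ i = 1)
    {H : (∀ i, α i) → ℝ≥0∞} (hH : Measurable H) :
    ∫⁻ y, H y ∂Measure.pi μ
      = ∫⁻ y, w (y i) * ∫⁻ u, H (Function.update y i u) ∂μ i ∂Measure.pi μ := by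
  have hup : Measurable fun p : (∀ i, α i) × α i => Function.update p.1 i p.2 := by
    fun_prop
  have hm : Measurable fun y : ∀ i, α i => ∫⁻ u, H (Function.update y i u) ∂μ i :=
    Measurable.lintegral_prod_right' (f := fun p : (∀ i, α i) × α i =>
      H (Function.update p.1 i p.2)) (hH.comp hup)
  -- Both integrands have the same marginal in coordinate `i`: after the inner integral, only `w`
  -- still depends on it, and `w` has mass one.
  refine lintegral_eq_of_lmarginal_eq {i} hH ((hw.comp (measurable_pi_apply i)).mul hm) ?_
  rw [lmarginal_singleton, lmarginal_singleton]
  ext y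
  simp only [Function.update_self, Function.update_idem]
  rw [lintegral_mul_const _ hw, h1, one_mul]

end PiSwap

/-! ### Complete data, dependence on the past, and auxiliary densities. -/

namespace PanelModel

variable {n : ℕ} {Θ Y X A : Type*}
  [MeasurableSpace Y] [MeasurableSpace X] [MeasurableSpace A]

/-- Redraw the outcome `y i`. -/
def setY (i : Fin (n + 2)) (z : (YPath n Y × XPath n X) × A) (u : Y) :
    (YPath n Y × XPath n X) × A :=
  ((Function.update z.1.1 i u, z.1.2), z.2)

/-- Redraw the regressor `x i`. -/
def setX (i : Fin (n + 1)) (z : (YPath n Y × XPath n X) × A) (u : X) :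
    (YPath n Y × XPath n X) × A :=
  ((z.1.1, Function.update z.1.2 i u), z.2)

lemma measurable_setY (i : Fin (n + 2)) :
    Measurable (fun p : ((YPath n Y × XPath n X) × A) × Y => setY i p.1 p.2) := by
  unfold setY; fun_prop

lemma measurable_setX (i : Fin (n + 1)) :
    Measurable (fun p : ((YPath n Y × XPath n X) × A) × X => setX i p.1 p.2) := by
  unfold setX; fun_prop

/-- `z` and `z'` agree in `a`, in `y i` for `i ≤ j` and in `x i` for `i ≤ k`. -/
def Agree (j k : ℕ) (z z' : (YPath n Y × XPath n X) × A) : Prop :=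
  (∀ i, i.val ≤ j → z.1.1 i = z'.1.1 i) ∧ (∀ i, i.val ≤ k → z.1.2 i = z'.1.2 i) ∧ z.2 = z'.2

/-- `H` depends on `a`, on `y i` for `i ≤ j` and on `x i` for `i ≤ k` only. -/
def DependsOnPast {β : Type*} (j k : ℕ) (H : (YPath n Y × XPath n X) × A → β) : Prop :=
  ∀ z z', Agree j k z z' → H z = H z'

omit [MeasurableSpace Y] [MeasurableSpace X] [MeasurableSpace A] in
lemma Agree.mono {j k j' k' : ℕ} {z z' : (YPath n Y × XPath n X) × A} (h : Agree j k z z')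
    (hj : j' ≤ j) (hk : k' ≤ k) : Agree j' k' z z' :=
  ⟨fun i hi => h.1 i (hi.trans hj), fun i hi => h.2.1 i (hi.trans hk), h.2.2⟩

omit [MeasurableSpace Y] [MeasurableSpace X] [MeasurableSpace A] in
lemma DependsOnPast.mono {β : Type*} {j k j' k' : ℕ} {H : (YPath n Y × XPath n X) × A → β}
    (h : DependsOnPast j k H) (hj : j ≤ j') (hk : k ≤ k') : DependsOnPast j' k' H :=
  fun z z' hz => h z z' (hz.mono hj hk)

omit [MeasurableSpace Y] [MeasurableSpace X] [MeasurableSpace A] in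
lemma agree_setY {j : ℕ} {i : Fin (n + 2)} (hj : j < i.val) (k : ℕ)
    (z : (YPath n Y × XPath n X) × A) (u : Y) : Agree j k (setY i z u) z :=
  ⟨fun r hr => Function.update_of_ne (by rintro rfl; omega) _ _, fun _ _ => rfl, rfl⟩

omit [MeasurableSpace Y] [MeasurableSpace X] [MeasurableSpace A] in
lemma agree_setX {k : ℕ} {i : Fin (n + 1)} (hk : k < i.val) (j : ℕ)
    (z : (YPath n Y × XPath n X) × A) (u : X) : Agree j k (setX i z u) z :=
  ⟨fun _ _ => rfl, fun r hr => Function.update_of_ne (by rintro rfl; omega) _ _, rfl⟩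

omit [MeasurableSpace Y] [MeasurableSpace X] [MeasurableSpace A] in
lemma Agree.setY {j k : ℕ} {i : Fin (n + 2)} (hi : i.val = j + 1)
    {z z' : (YPath n Y × XPath n X) × A} (h : Agree j k z z') (u : Y) :
    Agree (j + 1) k (setY i z u) (setY i z' u) := by
  refine ⟨fun r hr => ?_, h.2.1, h.2.2⟩
  rcases eq_or_ne r i with rfl | hne
  · simp [PanelModel.setY]
  · have : r.val ≠ i.val := fun h => hne (Fin.ext h)
    simpa [PanelModel.setY, hne] using h.1 r (by omega)

omit [MeasurableSpace Y] [MeasurableSpace X] [MeasurableSpace A] in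
lemma Agree.setX {j k : ℕ} {i : Fin (n + 1)} (hi : i.val = k + 1)
    {z z' : (YPath n Y × XPath n X) × A} (h : Agree j k z z') (u : X) :
    Agree j (k + 1) (setX i z u) (setX i z' u) := by
  refine ⟨h.1, fun r hr => ?_, h.2.2⟩
  rcases eq_or_ne r i with rfl | hne
  · simp [PanelModel.setX]
  · have : r.val ≠ i.val := fun h => hne (Fin.ext h)
    simpa [PanelModel.setX, hne] using h.2.1 r (by omega)

variable (M : PanelModel n Θ Y X A)

instance : SigmaFinite M.refObs := by unfold refObs; infer_instance

instance : SigmaFinite M.refFull := by unfold refFull; infer_instance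

/-- Positive probability densities of the single coordinates. -/
structure MarginalDensities where
  wY : Fin (n + 2) → Y → ℝ
  wX : Fin (n + 1) → X → ℝ
  wY_measurable : ∀ i, Measurable (wY i)
  wX_measurable : ∀ i, Measurable (wX i)
  wY_pos : ∀ i u, 0 < wY i u
  wX_pos : ∀ i u, 0 < wX i u
  wY_lintegral : ∀ i, ∫⁻ u, ENNReal.ofReal (wY i u) ∂(M.refY i) = 1
  wX_lintegral : ∀ i, ∫⁻ u, ENNReal.ofReal (wX i u) ∂(M.refX i) = 1

variable {M}

/-- The reference measures are only σ-finite and could be zero; the existence of one `ω`, whose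
densities integrate to one, rules this out. -/
lemma nonempty_marginalDensities (θ : Θ) (ω : M.Nuisance) : Nonempty M.MarginalDensities := by
  have hY0 : M.refY 0 ≠ 0 := fun h => by
    have := ω.nu_lintegral; rw [h] at this; simp at this
  have hX0 : M.refX 0 ≠ 0 := fun h => by
    have := ω.nu_lintegral; rw [h] at this; simp at this
  have hYn : Nonempty Y := by
    by_contra hne
    rw [not_nonempty_iff] at hne
    exact hY0 (Measure.eq_zero_of_isEmpty _)
  have hXn : Nonempty X := by
    by_contra hne
    rw [not_nonempty_iff] at hne
    exact hX0 (Measure.eq_zero_of_isEmpty _)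
  obtain ⟨y⟩ := hYn
  obtain ⟨x⟩ := hXn
  have hA : M.refA ≠ 0 := fun h => by
    have := ω.pi_lintegral y x; rw [h] at this; simp at this
  have hAn : Nonempty A := by
    by_contra hne
    rw [not_nonempty_iff] at hne
    exact hA (Measure.eq_zero_of_isEmpty _)
  obtain ⟨a⟩ := hAn
  have hY : ∀ i, M.refY i ≠ 0 := fun i => by
    refine Fin.cases hY0 (fun t h => ?_) i
    have := M.f_lintegral θ t y x a; rw [h] at this; simp at this
  have hX : ∀ i, M.refX i ≠ 0 := fun i => by
    refine Fin.cases hX0 (fun t h => ?_) i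
    have := ω.g_lintegral t (fun _ => y) (fun _ => x) a; rw [h] at this; simp at this
  choose wY hY1 hY2 hY3 using fun i => exists_pos_density (hY i)
  choose wX hX1 hX2 hX3 using fun i => exists_pos_density (hX i)
  exact ⟨⟨wY, wX, hY1, hX1, hY2, hX2, hY3, hX3⟩⟩

lemma lintegral_refFull_swapY (D : M.MarginalDensities) (i : Fin (n + 2))
    {H : (YPath n Y × XPath n X) × A → ℝ≥0∞} (hH : Measurable H) :
    ∫⁻ z, H z ∂M.refFull = ∫⁻ z, ENNReal.ofReal (D.wY i (z.1.1 i)) *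
      ∫⁻ u, H (setY i z u) ∂(M.refY i) ∂M.refFull := by
  have hw := D.wY_measurable i
  have hset := measurable_setY (n := n) (Y := Y) (X := X) (A := A) i
  have hm : Measurable fun z : (YPath n Y × XPath n X) × A => ENNReal.ofReal (D.wY i (z.1.1 i)) *
      ∫⁻ u, H (setY i z u) ∂(M.refY i) :=
    Measurable.mul (by fun_prop) (Measurable.lintegral_prod_right'
      (f := fun p : ((YPath n Y × XPath n X) × A) × Y => H (setY i p.1 p.2)) (hH.comp hset))
  rw [refFull, lintegral_prod_symm' _ hH, lintegral_prod_symm' _ hm]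
  refine lintegral_congr fun a => ?_
  have hHa : Measurable fun w => H (w, a) := hH.comp measurable_prodMk_right
  have hma : Measurable fun w : YPath n Y × XPath n X => ENNReal.ofReal (D.wY i (w.1 i)) *
      ∫⁻ u, H (setY i (w, a) u) ∂(M.refY i) := hm.comp measurable_prodMk_right
  rw [refObs, lintegral_prod_symm' _ hHa, lintegral_prod_symm' _ hma]
  refine lintegral_congr fun x => ?_
  exact lintegral_pi_swap M.refY i (w := fun u => ENNReal.ofReal (D.wY i u)) (by fun_prop)
    (D.wY_lintegral i) (H := fun y => H ((y, x), a)) (by fun_prop)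

lemma lintegral_refFull_swapX (D : M.MarginalDensities) (i : Fin (n + 1))
    {H : (YPath n Y × XPath n X) × A → ℝ≥0∞} (hH : Measurable H) :
    ∫⁻ z, H z ∂M.refFull = ∫⁻ z, ENNReal.ofReal (D.wX i (z.1.2 i)) *
      ∫⁻ u, H (setX i z u) ∂(M.refX i) ∂M.refFull := by
  have hw := D.wX_measurable i
  have hset := measurable_setX (n := n) (Y := Y) (X := X) (A := A) i
  have hm : Measurable fun z : (YPath n Y × XPath n X) × A => ENNReal.ofReal (D.wX i (z.1.2 i)) *
      ∫⁻ u, H (setX i z u) ∂(M.refX i) :=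
    Measurable.mul (by fun_prop) (Measurable.lintegral_prod_right'
      (f := fun p : ((YPath n Y × XPath n X) × A) × X => H (setX i p.1 p.2)) (hH.comp hset))
  rw [refFull, lintegral_prod_symm' _ hH, lintegral_prod_symm' _ hm]
  refine lintegral_congr fun a => ?_
  have hHa : Measurable fun w => H (w, a) := hH.comp measurable_prodMk_right
  have hma : Measurable fun w : YPath n Y × XPath n X => ENNReal.ofReal (D.wX i (w.2 i)) *
      ∫⁻ u, H (setX i (w, a) u) ∂(M.refX i) := hm.comp measurable_prodMk_right
  rw [refObs, lintegral_prod _ hHa.aemeasurable, lintegral_prod _ hma.aemeasurable]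
  refine lintegral_congr fun y => ?_
  exact lintegral_pi_swap M.refX i (w := fun u => ENNReal.ofReal (D.wX i u)) (by fun_prop)
    (D.wX_lintegral i) (H := fun x => H ((y, x), a)) (by fun_prop)

/-! ### Stages between the initial conditions and the full law. -/

variable (M)

/-- The outcome density of period `t + 1` as a function of the complete data. -/
def fData (θ : Θ) (t : Fin (n + 1)) (z : (YPath n Y × XPath n X) × A) : ℝ :=
  M.fAt θ t z.1.1 z.1.2 z.2

variable {M}

/-- The feedback density of period `t + 2` as a function of the complete data. -/
def Nuisance.gData (ω : M.Nuisance) (t : Fin n) (z : (YPath n Y × XPath n X) × A) : ℝ :=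
  ω.g t (yPast (t.val + 1) (by omega) z.1.1) (xPast (t.val + 1) (by omega) z.1.2) z.2
    (z.1.2 t.succ)

lemma measurable_yPast (k : ℕ) (hk : k < n + 2) :
    Measurable (yPast k hk : YPath n Y → Fin (k + 1) → Y) := by
  unfold yPast; fun_prop

lemma measurable_xPast (k : ℕ) (hk : k < n + 2) :
    Measurable (xPast k hk : XPath n X → Fin k → X) := by
  unfold xPast; fun_prop

lemma measurable_pastData (k : ℕ) (hk : k < n + 2) :
    Measurable fun z : (YPath n Y × XPath n X) × A => (yPast k hk z.1.1, xPast k hk z.1.2, z.2) :=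
  ((measurable_yPast k hk).comp measurable_fst.fst).prodMk
    (((measurable_xPast k hk).comp measurable_fst.snd).prodMk measurable_snd)

lemma measurable_histData (t : Fin n) : Measurable fun z : (YPath n Y × XPath n X) × A =>
    (yPast (t.val + 1) (by omega) z.1.1, xPast (t.val + 1) (by omega) z.1.2, z.2,
      z.1.2 t.succ) :=
  ((measurable_yPast _ (by omega)).comp measurable_fst.fst).prodMk
    (((measurable_xPast _ (by omega)).comp measurable_fst.snd).prodMk
      (measurable_snd.prodMk ((measurable_pi_apply _).comp measurable_fst.snd)))

lemma measurable_fData (θ : Θ) (t : Fin (n + 1)) : Measurable (M.fData θ t) := by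
  unfold fData fAt
  have := M.f_measurable θ t
  exact this.comp (by fun_prop :
    Measurable fun z : (YPath n Y × XPath n X) × A =>
      (z.1.1 t.castSucc, z.1.2 t, z.2, z.1.1 t.succ))

lemma measurable_gData (ω : M.Nuisance) (t : Fin n) : Measurable (ω.gData t) := by
  exact (ω.g_measurable t).comp (measurable_histData t)

lemma dependsOnPast_fData (θ : Θ) (t : Fin (n + 1)) :
    DependsOnPast (t.val + 1) t.val (M.fData θ t) := fun z z' h => by
  simp only [fData, fAt]
  rw [h.1 t.castSucc (by simp), h.1 t.succ (by simp), h.2.1 t le_rfl, h.2.2]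

lemma dependsOnPast_gData (ω : M.Nuisance) (t : Fin n) :
    DependsOnPast (t.val + 1) (t.val + 1) (ω.gData t) := fun z z' h => by
  simp only [Nuisance.gData]
  rw [h.2.1 t.succ (by simp), h.2.2,
    show yPast (t.val + 1) (by omega) z.1.1 = yPast (t.val + 1) (by omega) z'.1.1 from
      funext fun i => h.1 _ (by simp only; omega),
    show xPast (t.val + 1) (by omega) z.1.2 = xPast (t.val + 1) (by omega) z'.1.2 from
      funext fun i => h.2.1 _ (by simp only; omega)]

lemma fData_nonneg (θ : Θ) (t : Fin (n + 1)) (z : (YPath n Y × XPath n X) × A) :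
    0 ≤ M.fData θ t z := M.f_nonneg _ _ _ _ _ _

lemma gData_pos (ω : M.Nuisance) (t : Fin n) (z : (YPath n Y × XPath n X) × A) :
    0 < ω.gData t z := ω.g_pos _ _ _ _ _

lemma fData_setY (θ : Θ) (t : Fin (n + 1)) (z : (YPath n Y × XPath n X) × A) (u : Y) :
    M.fData θ t (setY t.succ z u) = M.f θ t (z.1.1 t.castSucc) (z.1.2 t) z.2 u := by
  simp [fData, fAt, setY, Function.update_of_ne (Fin.castSucc_lt_succ (i := t)).ne]

lemma gData_setX (ω : M.Nuisance) (t : Fin n) (z : (YPath n Y × XPath n X) × A) (u : X) :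
    ω.gData t (setX t.succ z u) = ω.g t (yPast (t.val + 1) (by omega) z.1.1)
      (xPast (t.val + 1) (by omega) z.1.2) z.2 u := by
  have : xPast (t.val + 1) (by omega) (Function.update z.1.2 t.succ u)
      = xPast (t.val + 1) (by omega) z.1.2 := by
    funext i
    refine Function.update_of_ne (fun h => ?_) _ _
    have := congrArg Fin.val h
    simp only [Fin.val_succ] at this; omega
  simp [Nuisance.gData, setX, this]

lemma lintegral_fData_setY (θ : Θ) (t : Fin (n + 1)) (z : (YPath n Y × XPath n X) × A) :
    ∫⁻ u, ENNReal.ofReal (M.fData θ t (setY t.succ z u)) ∂(M.refY t.succ) = 1 := by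
  simp only [fData_setY]
  exact M.f_lintegral _ _ _ _ _

lemma lintegral_gData_setX (ω : M.Nuisance) (t : Fin n) (z : (YPath n Y × XPath n X) × A) :
    ∫⁻ u, ENNReal.ofReal (ω.gData t (setX t.succ z u)) ∂(M.refX t.succ) = 1 := by
  simp only [gData_setX]
  exact ω.g_lintegral _ _ _ _

/-- Outcome densities up to period `j`, marginal densities afterwards. -/
def yFactor (θ : Θ) (D : M.MarginalDensities) (j : ℕ) (r : Fin (n + 1))
    (z : (YPath n Y × XPath n X) × A) : ℝ :=
  if r.val < j then M.fData θ r z else D.wY r.succ (z.1.1 r.succ)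

/-- The first `k` feedback densities, marginal densities afterwards. -/
def xFactor (ω : M.Nuisance) (D : M.MarginalDensities) (k : ℕ) (r : Fin n)
    (z : (YPath n Y × XPath n X) × A) : ℝ :=
  if r.val < k then ω.gData r z else D.wX r.succ (z.1.2 r.succ)

/-- Density of the initial conditions and the latent variable. -/
def Nuisance.initData (ω : M.Nuisance) (z : (YPath n Y × XPath n X) × A) : ℝ :=
  ω.pi (z.1.1 0) (z.1.2 0) z.2 * ω.nu (z.1.1 0) (z.1.2 0)

/-- Law under which the `j` first outcomes and the `k` first feedback regressors follow the
model, while the later coordinates are independent draws. -/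
def stageDensity (θ : Θ) (ω : M.Nuisance) (D : M.MarginalDensities) (j k : ℕ)
    (z : (YPath n Y × XPath n X) × A) : ℝ :=
  (∏ r, yFactor θ D j r z) * (∏ r, xFactor ω D k r z) * ω.initData z

/-- The measure with density `stageDensity`. -/
def stage (θ : Θ) (ω : M.Nuisance) (D : M.MarginalDensities) (j k : ℕ) :
    Measure ((YPath n Y × XPath n X) × A) :=
  M.refFull.withDensity fun z => ENNReal.ofReal (stageDensity θ ω D j k z)

instance (θ : Θ) (ω : M.Nuisance) (D : M.MarginalDensities) (j k : ℕ) :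
    SFinite (stage θ ω D j k) := by unfold stage; infer_instance

variable (θ : Θ) (ω : M.Nuisance) (D : M.MarginalDensities)

lemma measurable_yFactor (j : ℕ) (r : Fin (n + 1)) : Measurable (yFactor θ D j r) := by
  unfold yFactor
  have := D.wY_measurable r.succ
  have := measurable_fData (M := M) θ r
  split_ifs <;> fun_prop

lemma measurable_xFactor (j : ℕ) (r : Fin n) : Measurable (xFactor ω D j r) := by
  unfold xFactor
  have := D.wX_measurable r.succ
  have := measurable_gData ω r
  split_ifs <;> fun_prop

lemma measurable_initData : Measurable ω.initData := by
  unfold Nuisance.initData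
  exact (ω.pi_measurable.comp (by fun_prop : Measurable
    fun z : (YPath n Y × XPath n X) × A => (z.1.1 0, z.1.2 0, z.2))).mul
    (ω.nu_measurable.comp (by fun_prop : Measurable
    fun z : (YPath n Y × XPath n X) × A => (z.1.1 0, z.1.2 0)))

lemma initData_pos (z : (YPath n Y × XPath n X) × A) : 0 < ω.initData z :=
  mul_pos (ω.pi_pos _ _ _) (ω.nu_pos _ _)

lemma yFactor_nonneg (j : ℕ) (r : Fin (n + 1)) (z : (YPath n Y × XPath n X) × A) :
    0 ≤ yFactor θ D j r z := by
  unfold yFactor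
  split_ifs
  exacts [fData_nonneg _ _ _, (D.wY_pos _ _).le]

lemma xFactor_pos (k : ℕ) (r : Fin n) (z : (YPath n Y × XPath n X) × A) :
    0 < xFactor ω D k r z := by
  unfold xFactor
  split_ifs
  exacts [gData_pos _ _ _, D.wX_pos _ _]

lemma measurable_stageDensity (j k : ℕ) : Measurable (stageDensity θ ω D j k) := by
  unfold stageDensity
  have := measurable_yFactor θ D j
  have := measurable_xFactor ω D k
  have := measurable_initData ω
  fun_prop

/-- Only the densities f may vanish; the feedback, initial and auxiliary factors are all positive.
Hence `k` plays no role in the answer. -/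
lemma stageDensity_pos_iff (j k : ℕ) (z : (YPath n Y × XPath n X) × A) :
    0 < stageDensity θ ω D j k z ↔ M.Attainable θ j z.1.1 z.1.2 z.2 := by
  have h : 0 < ∏ r, yFactor θ D j r z ↔ M.Attainable θ j z.1.1 z.1.2 z.2 := by
    constructor
    · intro h r hr
      have := (yFactor_nonneg θ D j r z).lt_of_ne'
        (Finset.prod_ne_zero_iff.1 h.ne' r (Finset.mem_univ _))
      simpa [yFactor, hr] using! this
    · refine fun h => Finset.prod_pos fun r _ => ?_
      unfold yFactor
      split_ifs with hr
      exacts [h r hr, D.wY_pos _ _]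
  rw [← h, stageDensity, mul_pos_iff_of_pos_right (initData_pos ω z),
    mul_pos_iff_of_pos_right (Finset.prod_pos fun r _ => xFactor_pos ω D k r z)]

lemma ae_stage_iff (j k : ℕ) {S : (YPath n Y × XPath n X) × A → Prop} :
    (∀ᵐ z ∂stage θ ω D j k, S z) ↔
      ∀ᵐ z ∂M.refFull, M.Attainable θ j z.1.1 z.1.2 z.2 → S z := by
  have := measurable_stageDensity θ ω D j k
  rw [stage, ae_withDensity_iff (by fun_prop)]
  simp only [ne_eq, ENNReal.ofReal_eq_zero, not_le, stageDensity_pos_iff]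

lemma stageDensity_last (z : (YPath n Y × XPath n X) × A) :
    stageDensity θ ω D (n + 1) n z = M.fullDensity θ ω z := by
  simp only [stageDensity, yFactor, xFactor, fullDensity, Fin.is_lt, if_true,
    Nuisance.initData, mul_assoc]
  rfl

lemma stage_last : stage θ ω D (n + 1) n = M.law θ ω := by
  simp only [stage, law, stageDensity_last]

omit [MeasurableSpace Y] [MeasurableSpace X] [MeasurableSpace A] in
lemma DependsOnPast.setY_eq {β : Type*} {j l : ℕ} {H : (YPath n Y × XPath n X) × A → β}
    (h : DependsOnPast j l H) {i : Fin (n + 2)} (hi : j < i.val)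
    (z : (YPath n Y × XPath n X) × A) (u : Y) : H (setY i z u) = H z :=
  h _ _ (agree_setY hi _ z u)

omit [MeasurableSpace Y] [MeasurableSpace X] [MeasurableSpace A] in
lemma DependsOnPast.setX_eq {β : Type*} {j l : ℕ} {H : (YPath n Y × XPath n X) × A → β}
    (h : DependsOnPast j l H) {i : Fin (n + 1)} (hi : l < i.val)
    (z : (YPath n Y × XPath n X) × A) (u : X) : H (setX i z u) = H z :=
  h _ _ (agree_setX hi _ z u)

/-- The factors of `stageDensity θ ω D k l` other than the density of `y (k + 1)`. -/
def yRest (k : Fin (n + 1)) (l : ℕ) (z : (YPath n Y × XPath n X) × A) : ℝ :=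
  (∏ r ∈ Finset.univ.erase k, yFactor θ D k.val r z) * (∏ r, xFactor ω D l r z) * ω.initData z

/-- The factors of `stageDensity θ ω D j k` other than the density of `x (k + 1)`. -/
def xRest (j : ℕ) (k : Fin n) (z : (YPath n Y × XPath n X) × A) : ℝ :=
  (∏ r, yFactor θ D j r z) * (∏ r ∈ Finset.univ.erase k, xFactor ω D k.val r z) * ω.initData z

lemma stageDensity_eq_yRest (k : Fin (n + 1)) (l : ℕ) (z : (YPath n Y × XPath n X) × A) :
    stageDensity θ ω D k.val l z = yRest θ ω D k l z * D.wY k.succ (z.1.1 k.succ) := by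
  rw [stageDensity, yRest,
    ← Finset.mul_prod_erase _ (fun r => yFactor θ D k.val r z) (Finset.mem_univ k)]
  simp only [yFactor, lt_irrefl, if_false]
  ring

lemma stageDensity_succ_eq_yRest (k : Fin (n + 1)) (l : ℕ) (z : (YPath n Y × XPath n X) × A) :
    stageDensity θ ω D (k.val + 1) l z = yRest θ ω D k l z * M.fData θ k z := by
  rw [stageDensity, yRest,
    ← Finset.mul_prod_erase _ (fun r => yFactor θ D (k.val + 1) r z) (Finset.mem_univ k),
    Finset.prod_congr (s₁ := Finset.univ.erase k) rfl (g := fun r => yFactor θ D k.val r z)]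
  · simp only [yFactor, Nat.lt_succ_self, if_true]
    ring
  · intro r hr
    have hne : r.val ≠ k.val := fun h => Finset.ne_of_mem_erase hr (Fin.ext h)
    simp only [yFactor, Nat.lt_succ_iff, hne.le_iff_lt]

lemma stageDensity_eq_xRest (j : ℕ) (k : Fin n) (z : (YPath n Y × XPath n X) × A) :
    stageDensity θ ω D j k.val z = xRest θ ω D j k z * D.wX k.succ (z.1.2 k.succ) := by
  rw [stageDensity, xRest,
    ← Finset.mul_prod_erase _ (fun r => xFactor ω D k.val r z) (Finset.mem_univ k)]
  simp only [xFactor, lt_irrefl, if_false]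
  ring

lemma stageDensity_succ_eq_xRest (j : ℕ) (k : Fin n) (z : (YPath n Y × XPath n X) × A) :
    stageDensity θ ω D j (k.val + 1) z = xRest θ ω D j k z * ω.gData k z := by
  rw [stageDensity, xRest,
    ← Finset.mul_prod_erase _ (fun r => xFactor ω D (k.val + 1) r z) (Finset.mem_univ k),
    Finset.prod_congr (s₁ := Finset.univ.erase k) rfl (g := fun r => xFactor ω D k.val r z)]
  · simp only [xFactor, Nat.lt_succ_self, if_true]
    ring
  · intro r hr
    have hne : r.val ≠ k.val := fun h => Finset.ne_of_mem_erase hr (Fin.ext h)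
    simp only [xFactor, Nat.lt_succ_iff, hne.le_iff_lt]

lemma measurable_yRest (k : Fin (n + 1)) (l : ℕ) : Measurable (yRest θ ω D k l) := by
  unfold yRest
  have := measurable_yFactor θ D k.val
  have := measurable_xFactor ω D l
  have := measurable_initData ω
  fun_prop

lemma measurable_xRest (j : ℕ) (k : Fin n) : Measurable (xRest θ ω D j k) := by
  unfold xRest
  have := measurable_yFactor θ D j
  have := measurable_xFactor ω D k.val
  have := measurable_initData ω
  fun_prop

lemma yRest_nonneg (k : Fin (n + 1)) (l : ℕ) (z : (YPath n Y × XPath n X) × A) :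
    0 ≤ yRest θ ω D k l z :=
  mul_nonneg (mul_nonneg (Finset.prod_nonneg fun r _ => yFactor_nonneg θ D _ r z)
    (Finset.prod_nonneg fun r _ => (xFactor_pos ω D _ r z).le)) (initData_pos ω z).le

lemma xRest_nonneg (j : ℕ) (k : Fin n) (z : (YPath n Y × XPath n X) × A) :
    0 ≤ xRest θ ω D j k z :=
  mul_nonneg (mul_nonneg (Finset.prod_nonneg fun r _ => yFactor_nonneg θ D _ r z)
    (Finset.prod_nonneg fun r _ => (xFactor_pos ω D _ r z).le)) (initData_pos ω z).le

/-- With as many feedback factors as outcome factors, those present involve outcomes up to index `k`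
only, so the outcome of index `k + 1` occurs nowhere else. -/
lemma yRest_setY (k : Fin (n + 1)) (z : (YPath n Y × XPath n X) × A) (u : Y) :
    yRest θ ω D k k.val (setY k.succ z u) = yRest θ ω D k k.val z := by
  unfold yRest
  congr 1
  congr 1
  · refine Finset.prod_congr rfl fun r hr => ?_
    have hne := Finset.ne_of_mem_erase hr
    unfold yFactor
    split_ifs with h
    · exact (dependsOnPast_fData θ r).setY_eq (by simpa using h) z u
    · simp [setY, Function.update_of_ne (fun h => hne (Fin.succ_injective _ h))]
  · refine Finset.prod_congr rfl fun r _ => ?_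
    unfold xFactor
    split_ifs with h
    · exact (dependsOnPast_gData ω r).setY_eq (by simpa using h) z u
    · rfl

lemma xRest_setX (k : Fin n) (z : (YPath n Y × XPath n X) × A) (u : X) :
    xRest θ ω D (k.val + 1) k (setX k.succ z u) = xRest θ ω D (k.val + 1) k z := by
  unfold xRest
  congr 1
  congr 1
  · refine Finset.prod_congr rfl fun r _ => ?_
    unfold yFactor
    split_ifs with h
    · exact (dependsOnPast_fData θ r).setX_eq (by simpa using h) z u
    · rfl
  · refine Finset.prod_congr rfl fun r hr => ?_
    have hne := Finset.ne_of_mem_erase hr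
    unfold xFactor
    split_ifs with h
    · exact (dependsOnPast_gData ω r).setX_eq (by simpa using h) z u
    · simp [setX, Function.update_of_ne (fun h => hne (Fin.succ_injective _ h))]

lemma isStep_outcome (k : Fin (n + 1)) :
    IsStep (stage θ ω D k.val k.val) (stage θ ω D (k.val + 1) k.val) (M.refY k.succ)
      (setY k.succ) (M.fData θ k) := by
  have hw : Measurable fun z : (YPath n Y × XPath n X) × A => D.wY k.succ (z.1.1 k.succ) := by
    have := D.wY_measurable k.succ
    fun_prop
  simp only [stage, stageDensity_eq_yRest, stageDensity_succ_eq_yRest]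
  exact IsStep.of_swap (measurable_setY _) hw (measurable_yRest θ ω D k k.val)
    (measurable_fData θ k) (yRest_nonneg θ ω D k k.val) (fData_nonneg θ k) (yRest_setY θ ω D k)
    (fun H hH => lintegral_refFull_swapY D k.succ hH)

lemma isStep_feedback (k : Fin n) :
    IsStep (stage θ ω D (k.val + 1) k.val) (stage θ ω D (k.val + 1) (k.val + 1))
      (M.refX k.succ) (setX k.succ) (ω.gData k) := by
  have hw : Measurable fun z : (YPath n Y × XPath n X) × A => D.wX k.succ (z.1.2 k.succ) := by
    have := D.wX_measurable k.succ
    fun_prop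
  simp only [stage, stageDensity_eq_xRest, stageDensity_succ_eq_xRest]
  exact IsStep.of_swap (measurable_setX _) hw (measurable_xRest θ ω D (k.val + 1) k)
    (measurable_gData ω k) (xRest_nonneg θ ω D (k.val + 1) k) (fun z => (gData_pos ω k z).le)
    (xRest_setX θ ω D k) (fun H hH => lintegral_refFull_swapX D k.succ hH)

end PanelModel

/-! ### Iterated integrals and part (A). -/

namespace PanelModel

variable {n : ℕ} {Θ Y X A : Type*}
  [MeasurableSpace Y] [MeasurableSpace X] [MeasurableSpace A]
  {M : PanelModel n Θ Y X A}

section IteratedIntegral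

variable {E : Type*} [NormedAddCommGroup E] [NormedSpace ℝ E]

variable (M) in
/-- The iterated integral as a function of the complete data. -/
def iterData (θ : Θ) (F : YPath n Y → XPath n X → A → E) (k : Fin (n + 2))
    (z : (YPath n Y × XPath n X) × A) : E :=
  M.iterInt θ F k z.1.1 z.1.2 z.2

lemma iterData_last (θ : Θ) (F : YPath n Y → XPath n X → A → E) :
    M.iterData θ F (Fin.last (n + 1)) = fun z => F z.1.1 z.1.2 z.2 := by
  ext z
  simp [iterData, iterInt]

lemma iterData_castSucc (θ : Θ) (F : YPath n Y → XPath n X → A → E) (t : Fin (n + 1)) :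
    M.iterData θ F t.castSucc
      = stepAvg (M.refY t.succ) (setY t.succ) (M.fData θ t) (M.iterData θ F t.succ) := by
  ext z
  simp only [iterData, iterInt, stepAvg, fData_setY, Fin.reverseInduction_castSucc]
  rfl

lemma stronglyMeasurable_iterData (θ : Θ) (ω : M.Nuisance) (D : M.MarginalDensities)
    {F : YPath n Y → XPath n X → A → E}
    (hF : StronglyMeasurable fun z : (YPath n Y × XPath n X) × A => F z.1.1 z.1.2 z.2)
    (k : Fin (n + 2)) : StronglyMeasurable (M.iterData θ F k) := by
  induction k using Fin.reverseInduction with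
  | last => rw [iterData_last]; exact hF
  | cast t ih =>
    rw [iterData_castSucc]
    exact (isStep_outcome θ ω D t).stronglyMeasurable_avg ih

end IteratedIntegral

section Sufficiency

variable {E : Type*} [NormedAddCommGroup E] [NormedSpace ℝ E] [CompleteSpace E]
  [MeasurableSpace E] [BorelSpace E] [SecondCountableTopology E]

/-- The mean of F is carried backwards through one outcome and one regressor at a time;
integrability has to travel along, since Bochner integrals are zero by default without it. -/
lemma Restrictions.integral_iterData (θ : Θ) (ω : M.Nuisance) (D : M.MarginalDensities)
    {F : YPath n Y → XPath n X → A → E} (hR : M.Restrictions θ F)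
    (hF : StronglyMeasurable fun z : (YPath n Y × XPath n X) × A => F z.1.1 z.1.2 z.2)
    (hi : Integrable (fun z => F z.1.1 z.1.2 z.2) (M.law θ ω)) (k : Fin (n + 1)) :
    Integrable (M.iterData θ F k.succ) (stage θ ω D (k.val + 1) k.val) ∧
      ∫ z, M.iterData θ F k.succ z ∂stage θ ω D (k.val + 1) k.val
        = ∫ z, F z.1.1 z.1.2 z.2 ∂M.law θ ω := by
  induction k using Fin.reverseInduction with
  | last =>
    rw [Fin.succ_last, iterData_last, Fin.val_last, stage_last]
    exact ⟨hi, rfl⟩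
  | cast j ih =>
    have hG := stronglyMeasurable_iterData θ ω D hF
    have hY := isStep_outcome θ ω D j.succ
    have hX := isStep_feedback θ ω D j
    have h1 := hY.integrable_avg (hG _) ih.1
    have h2 := hY.integral_avg (hG _) ih.1
    rw [← iterData_castSucc, ← Fin.succ_castSucc] at h1 h2
    obtain ⟨m, hm, hae⟩ := hR.feedback j
    set m' : (YPath n Y × XPath n X) × A → E := fun z =>
      m (yPast (j.val + 1) (by omega) z.1.1) (xPast (j.val + 1) (by omega) z.1.2) z.2 with hm'
    have hmm : StronglyMeasurable m' :=
      (hm.comp (measurable_pastData (j.val + 1) (by omega))).stronglyMeasurable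
    -- The past in `m` stops at regressor index `j`, just before the index `j + 1` that is redrawn.
    have hinv : ∀ z u, m' (setX j.succ z u) = m' z := fun z u => by
      simp only [hm']
      congr 1
      funext i
      refine Function.update_of_ne (fun h => ?_) _ _
      have := congrArg Fin.val h
      simp only [Fin.val_succ] at this; omega
    -- One restriction is read in two stages, after and before the draw of the regressor; they have
    -- the same null sets.
    have hB : M.iterData θ F j.castSucc.succ =ᵐ[stage θ ω D (j.val + 1) (j.val + 1)] m' :=
      (ae_stage_iff θ ω D _ _).2 hae
    have hC : M.iterData θ F j.castSucc.succ =ᵐ[stage θ ω D (j.val + 1) j.val] m' :=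
      (ae_stage_iff θ ω D _ _).2 hae
    have hmB : Integrable m' (stage θ ω D (j.val + 1) (j.val + 1)) := Integrable.congr h1 hB
    have hone := lintegral_gData_setX ω j
    have hmC : Integrable m' (stage θ ω D (j.val + 1) j.val) :=
      (hX.integrable_iff_of_invariant hone hmm hinv).1 hmB
    refine ⟨hmC.congr hC.symm, ?_⟩
    rw [← ih.2, ← h2]
    have e1 := integral_congr_ae hB
    have e2 := integral_congr_ae hC
    have e3 := hX.integral_eq_of_invariant hone hmm hmC hinv
    exact e2.trans (e3.symm.trans e1.symm)

/-- A function that satisfies the restrictions has mean zero whenever it is integrable. -/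
theorem Restrictions.integral_eq_zero {θ : Θ} {ω : M.Nuisance}
    {F : YPath n Y → XPath n X → A → E} (hR : M.Restrictions θ F)
    (hF : StronglyMeasurable fun z : (YPath n Y × XPath n X) × A => F z.1.1 z.1.2 z.2)
    (hi : Integrable (fun z => F z.1.1 z.1.2 z.2) (M.law θ ω)) :
    ∫ z, F z.1.1 z.1.2 z.2 ∂M.law θ ω = 0 := by
  obtain ⟨D⟩ := nonempty_marginalDensities θ ω
  obtain ⟨h1, h2⟩ := hR.integral_iterData θ ω D hF hi 0
  have hY := isStep_outcome θ ω D 0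
  rw [← h2]
  refine (hY.integral_avg (stronglyMeasurable_iterData θ ω D hF _) h1).symm.trans ?_
  rw [← iterData_castSucc]
  refine integral_eq_zero_of_ae ((ae_stage_iff θ ω D _ _).2 ?_)
  filter_upwards [hR.hetero] with z hz _ using hz

end Sufficiency

/-! ### Finiteness of the law. -/

section Mass

lemma lintegral_pi_densities_mul_lt_top {m : ℕ} {α : Type*} [MeasurableSpace α]
    {μ : Fin (m + 1) → Measure α} [∀ i, SigmaFinite (μ i)] {w : Fin (m + 1) → α → ℝ}
    (hw : ∀ i, Measurable (w i)) (hpos : ∀ i u, 0 < w i u)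
    (h1 : ∀ i, ∫⁻ u, ENNReal.ofReal (w i u) ∂μ i = 1) :
    ∃ C : ℝ≥0∞, C < ⊤ ∧ ∀ ψ : α → ℝ≥0∞, Measurable ψ →
      ∫⁻ x, ENNReal.ofReal (∏ r : Fin m, w r.succ (x r.succ)) * ψ (x 0) ∂Measure.pi μ
        = C * ∫⁻ u, ψ u ∂μ 0 := by
  refine ⟨∫⁻ x, ENNReal.ofReal (∏ i, w i (x i)) ∂Measure.pi μ, ?_, fun ψ hψ => ?_⟩
  · have := Integrable.fintype_prod_dep (𝕜 := ℝ) (μ := μ) (f := w)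
      (fun i => integrable_density (hw i) (fun u => (hpos i u).le) (h1 i))
    rw [← hasFiniteIntegral_iff_ofReal
      (ae_of_all _ fun x => Finset.prod_nonneg fun i _ => (hpos i _).le)]
    exact this.2
  -- The product lacks the density of coordinate 0. Swapping that coordinate inserts it and
  -- separates `ψ`, so the constant is the mass of the full product density.
  · rw [lintegral_pi_swap μ 0 (w := fun u => ENNReal.ofReal (w 0 u)) (by fun_prop) (h1 0)
      (by fun_prop), ← lintegral_mul_const _ (by fun_prop)]
    refine lintegral_congr fun x => ?_
    simp only [Function.update_self, Function.update_of_ne (Fin.succ_ne_zero _)]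
    rw [lintegral_const_mul _ hψ, Fin.prod_univ_succ, ENNReal.ofReal_mul (hpos 0 _).le, mul_assoc]

lemma lintegral_stage_zero_lt_top (θ : Θ) (ω : M.Nuisance) (D : M.MarginalDensities) :
    ∫⁻ _, 1 ∂stage θ ω D 0 0 < ⊤ := by
  obtain ⟨CY, hCY, hY⟩ := lintegral_pi_densities_mul_lt_top D.wY_measurable D.wY_pos D.wY_lintegral
  obtain ⟨CX, hCX, hX⟩ := lintegral_pi_densities_mul_lt_top D.wX_measurable D.wX_pos D.wX_lintegral
  have hν : Measurable fun p : Y × X => ENNReal.ofReal (ω.nu p.1 p.2) := by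
    have := ω.nu_measurable
    fun_prop
  have hWY : Measurable fun y : YPath n Y =>
      ENNReal.ofReal (∏ r : Fin (n + 1), D.wY r.succ (y r.succ)) := by
    have := D.wY_measurable
    fun_prop
  have hWX : Measurable fun x : XPath n X =>
      ENNReal.ofReal (∏ r : Fin n, D.wX r.succ (x r.succ)) := by
    have := D.wX_measurable
    fun_prop
  have hd := measurable_stageDensity θ ω D 0 0
  have key : ∫⁻ _, 1 ∂stage θ ω D 0 0 = CX * CY := by
    rw [stage, lintegral_withDensity_eq_lintegral_mul _ (by fun_prop) measurable_const, refFull,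
      lintegral_prod _ (by fun_prop)]
    have e1 : ∀ w : YPath n Y × XPath n X,
        ∫⁻ a, ENNReal.ofReal (stageDensity θ ω D 0 0 (w, a)) ∂M.refA
        = ENNReal.ofReal (∏ r : Fin (n + 1), D.wY r.succ (w.1 r.succ)) *
          (ENNReal.ofReal (∏ r : Fin n, D.wX r.succ (w.2 r.succ)) *
            ENNReal.ofReal (ω.nu (w.1 0) (w.2 0))) := by
      intro w
      have hπ : Measurable fun a => ENNReal.ofReal (ω.pi (w.1 0) (w.2 0) a) := by
        have : Measurable fun a => ω.pi (w.1 0) (w.2 0) a := ω.pi_measurable.comp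
          (by fun_prop : Measurable fun a : A => (w.1 0, w.2 0, a))
        fun_prop
      have hY0 : 0 ≤ ∏ r : Fin (n + 1), D.wY r.succ (w.1 r.succ) :=
        Finset.prod_nonneg fun r _ => (D.wY_pos _ _).le
      have hX0 : 0 ≤ ∏ r : Fin n, D.wX r.succ (w.2 r.succ) :=
        Finset.prod_nonneg fun r _ => (D.wX_pos _ _).le
      simp only [stageDensity, yFactor, xFactor, not_lt_zero, if_false,
        Nuisance.initData, ENNReal.ofReal_mul (mul_nonneg hY0 hX0), ENNReal.ofReal_mul hY0,
        ENNReal.ofReal_mul (ω.pi_pos _ _ _).le]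
      rw [lintegral_const_mul _ (by fun_prop), lintegral_mul_const _ hπ, ω.pi_lintegral, one_mul,
        mul_assoc]
    simp only [Pi.mul_apply, mul_one, e1]
    rw [refObs, lintegral_prod _ (by
      exact ((hWY.comp measurable_fst).mul ((hWX.comp measurable_snd).mul (hν.comp
        (by fun_prop : Measurable fun w : YPath n Y × XPath n X => (w.1 0, w.2 0))))).aemeasurable)]
    have e2 : ∀ y : YPath n Y, ∫⁻ x, ENNReal.ofReal (∏ r : Fin (n + 1), D.wY r.succ (y r.succ)) *
          (ENNReal.ofReal (∏ r : Fin n, D.wX r.succ (x r.succ)) *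
            ENNReal.ofReal (ω.nu (y 0) (x 0))) ∂Measure.pi M.refX
        = CX * (ENNReal.ofReal (∏ r : Fin (n + 1), D.wY r.succ (y r.succ)) *
          ∫⁻ u, ENNReal.ofReal (ω.nu (y 0) u) ∂M.refX 0) := by
      intro y
      have hνy : Measurable fun u => ENNReal.ofReal (ω.nu (y 0) u) :=
        hν.comp measurable_prodMk_left
      rw [lintegral_const_mul _ (by exact hWX.mul (hνy.comp (measurable_pi_apply 0))), hX _ hνy]
      ring
    simp_rw [e2]
    have hν' : Measurable fun v => ∫⁻ u, ENNReal.ofReal (ω.nu v u) ∂M.refX 0 :=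
      hν.lintegral_prod_right'
    rw [lintegral_const_mul _ (by exact hWY.mul (hν'.comp (measurable_pi_apply 0))), hY _ hν',
      ω.nu_lintegral, mul_one]
  rw [key]
  exact ENNReal.mul_lt_top hCX hCY

/-- Each step preserves total mass, so it suffices to compute it at `stage 0 0`. Finiteness is what
turns the second moment bounds into integrability. -/
instance (θ : Θ) (ω : M.Nuisance) : IsFiniteMeasure (M.law θ ω) := by
  obtain ⟨D⟩ := nonempty_marginalDensities θ ω
  have h : ∀ k : Fin (n + 1), ∫⁻ _, 1 ∂stage θ ω D (k.val + 1) k.val = ∫⁻ _, 1 ∂stage θ ω D 0 0 := by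
    have hY := fun k => (isStep_outcome θ ω D k).lintegral_eq_of_invariant
      (lintegral_fData_setY θ k) (measurable_const (a := (1 : ℝ≥0∞))) (fun _ _ => rfl)
    intro k
    induction k using Fin.induction with
    | zero => exact hY 0
    | succ j ih =>
      rw [← ih, hY j.succ]
      exact (isStep_feedback θ ω D j).lintegral_eq_of_invariant
        (lintegral_gData_setX ω j) (measurable_const (a := (1 : ℝ≥0∞))) (fun _ _ => rfl)
  refine ⟨?_⟩
  rw [← lintegral_one, ← stage_last θ ω D]
  exact (h (Fin.last n)).trans_lt (lintegral_stage_zero_lt_top θ ω D)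

end Mass

end PanelModel

/-! ### Tilting the nuisance parameters. -/

lemma measurable_tiltDensity {V U : Type*} [MeasurableSpace V] [MeasurableSpace U]
    {κ : Measure U} [SFinite κ] {d b : V → U → ℝ} (hd : Measurable fun p : V × U => d p.1 p.2)
    (hb : Measurable fun p : V × U => b p.1 p.2) :
    Measurable fun p : V × U => tiltDensity κ (d p.1) (b p.1) p.2 := by
  have hI : StronglyMeasurable fun v => ∫ u, d v u * b v u ∂κ :=
    StronglyMeasurable.integral_prod_right (f := fun v u => d v u * b v u)
      (hd.mul hb).stronglyMeasurable
  exact hd.mul (measurable_const.add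
    ((hb.sub (hI.measurable.comp measurable_fst)).div_const 4))

namespace PanelModel

variable {n : ℕ} {Θ Y X A : Type*}
  [MeasurableSpace Y] [MeasurableSpace X] [MeasurableSpace A]
  {M : PanelModel n Θ Y X A}

/-- Reweight the feedback densities. -/
def Nuisance.tiltG (ω : M.Nuisance)
    (β : (t : Fin n) → (Fin (t.val + 1 + 1) → Y) × (Fin (t.val + 1) → X) × A × X → ℝ)
    (hβ : ∀ t, Measurable (β t)) (hβ1 : ∀ t p, |β t p| ≤ 1) : M.Nuisance where
  __ := ω
  g t ys xs a u := tiltDensity (M.refX t.succ) (ω.g t ys xs a) (fun v => β t (ys, xs, a, v)) u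
  g_measurable t := by
    have e : Measurable fun p : ((Fin (t.val + 1 + 1) → Y) × (Fin (t.val + 1) → X) × A) × X =>
      (p.1.1, p.1.2.1, p.1.2.2, p.2) := by fun_prop
    have := measurable_tiltDensity (κ := M.refX t.succ)
      (d := fun (q : (Fin (t.val + 1 + 1) → Y) × (Fin (t.val + 1) → X) × A) u =>
        ω.g t q.1 q.2.1 q.2.2 u)
      (b := fun q v => β t (q.1, q.2.1, q.2.2, v))
      ((ω.g_measurable t).comp e) ((hβ t).comp e)
    exact this.comp (by fun_prop :
      Measurable fun q : (Fin (t.val + 1 + 1) → Y) × (Fin (t.val + 1) → X) × A × X =>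
        ((q.1, q.2.1, q.2.2.1), q.2.2.2))
  g_pos t ys xs a u := tiltDensity_pos
    ((ω.g_measurable t).comp (by fun_prop : Measurable fun u => (ys, xs, a, u)))
    (ω.g_pos t ys xs a) (ω.g_lintegral t ys xs a) (fun _ => hβ1 _ _) u
  g_lintegral t ys xs a := lintegral_tiltDensity
    ((ω.g_measurable t).comp (by fun_prop : Measurable fun u => (ys, xs, a, u)))
    (ω.g_pos t ys xs a) (ω.g_lintegral t ys xs a)
    ((hβ t).comp (by fun_prop : Measurable fun u => (ys, xs, a, u))) (fun _ => hβ1 _ _)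

/-- Reweight the density of the latent variable. -/
def Nuisance.tiltPi (ω : M.Nuisance) (β : Y × X × A → ℝ) (hβ : Measurable β)
    (hβ1 : ∀ p, |β p| ≤ 1) : M.Nuisance where
  __ := ω
  pi y x a := tiltDensity M.refA (ω.pi y x) (fun v => β (y, x, v)) a
  pi_measurable := by
    have e : Measurable fun p : (Y × X) × A => (p.1.1, p.1.2, p.2) := by fun_prop
    have := measurable_tiltDensity (κ := M.refA)
      (d := fun (q : Y × X) u => ω.pi q.1 q.2 u) (b := fun q v => β (q.1, q.2, v))
      (ω.pi_measurable.comp e) (hβ.comp e)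
    exact this.comp (by fun_prop : Measurable fun q : Y × X × A => ((q.1, q.2.1), q.2.2))
  pi_pos y x a := tiltDensity_pos
    (ω.pi_measurable.comp (by fun_prop : Measurable fun u => (y, x, u)))
    (ω.pi_pos y x) (ω.pi_lintegral y x) (fun _ => hβ1 _) a
  pi_lintegral y x := lintegral_tiltDensity
    (ω.pi_measurable.comp (by fun_prop : Measurable fun u => (y, x, u)))
    (ω.pi_pos y x) (ω.pi_lintegral y x)
    (hβ.comp (by fun_prop : Measurable fun u => (y, x, u))) (fun _ => hβ1 _)

lemma Nuisance.nu_lintegral_prod (ω : M.Nuisance) :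
    ∫⁻ p, ENNReal.ofReal (ω.nu p.1 p.2) ∂(M.refY 0).prod (M.refX 0) = 1 := by
  have := ω.nu_measurable
  rw [lintegral_prod _ (by fun_prop), ω.nu_lintegral]

/-- Reweight the density of the initial conditions. -/
def Nuisance.tiltNu (ω : M.Nuisance) (β : Y × X → ℝ) (hβ : Measurable β)
    (hβ1 : ∀ p, |β p| ≤ 1) : M.Nuisance where
  __ := ω
  nu y x := tiltDensity ((M.refY 0).prod (M.refX 0)) (fun p => ω.nu p.1 p.2) β (y, x)
  nu_measurable := by
    have := ω.nu_measurable
    unfold tiltDensity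
    fun_prop
  nu_pos y x := tiltDensity_pos ω.nu_measurable (fun p => ω.nu_pos p.1 p.2)
    ω.nu_lintegral_prod hβ1 (y, x)
  nu_lintegral := by
    have h := lintegral_tiltDensity ω.nu_measurable (fun p => ω.nu_pos p.1 p.2)
      ω.nu_lintegral_prod hβ hβ1
    rwa [lintegral_prod _ (by
      have := ω.nu_measurable
      unfold tiltDensity
      fun_prop)] at h

/-! ### Orthogonality relations obtained from tilts. -/

section Moments

variable {E : Type*} [NormedAddCommGroup E] [NormedSpace ℝ E]

/-- `F` has mean zero under `ω` and under all its bounded reweightings within the model. -/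
def TiltOrthogonal (θ : Θ) (ω : M.Nuisance) (F : (YPath n Y × XPath n X) × A → E) : Prop :=
  ∀ (ω' : M.Nuisance) (s : (YPath n Y × XPath n X) × A → ℝ), Measurable s →
    (∀ z, 0 ≤ s z ∧ s z ≤ 2) → (∀ z, M.fullDensity θ ω' z = M.fullDensity θ ω z * s z) →
    ∫ z, s z • F z ∂M.law θ ω = 0

variable {θ : Θ} {ω : M.Nuisance} {F : (YPath n Y × XPath n X) × A → E}

lemma fullDensity_nonneg (θ : Θ) (ω : M.Nuisance) (z : (YPath n Y × XPath n X) × A) :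
    0 ≤ M.fullDensity θ ω z := by
  obtain ⟨D⟩ := nonempty_marginalDensities θ ω
  rw [← stageDensity_last θ ω D]
  exact mul_nonneg (mul_nonneg (Finset.prod_nonneg fun r _ => yFactor_nonneg θ D _ r z)
    (Finset.prod_nonneg fun r _ => (xFactor_pos ω D _ r z).le)) (initData_pos ω z).le

lemma measurable_fullDensity (θ : Θ) (ω : M.Nuisance) : Measurable (M.fullDensity θ ω) := by
  obtain ⟨D⟩ := nonempty_marginalDensities θ ω
  rw [← funext (stageDensity_last θ ω D)]
  exact measurable_stageDensity θ ω D (n + 1) n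

lemma law_eq_withDensity {ω' : M.Nuisance} {s : (YPath n Y × XPath n X) × A → ℝ}
    (hs : Measurable s)
    (h : ∀ z, M.fullDensity θ ω' z = M.fullDensity θ ω z * s z) :
    M.law θ ω' = (M.law θ ω).withDensity fun z => ENNReal.ofReal (s z) := by
  have hd := measurable_fullDensity θ ω
  rw [law, law, ← withDensity_mul _ (by fun_prop) (by fun_prop)]
  refine congrArg _ (funext fun z => ?_)
  rw [h, ENNReal.ofReal_mul (fullDensity_nonneg θ ω z)]
  rfl

lemma integrable_bdd_smul {b : (YPath n Y × XPath n X) × A → ℝ} {C : ℝ}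
    {μ : Measure ((YPath n Y × XPath n X) × A)} (hF : Integrable F μ)
    (hb : Measurable b) (hb1 : ∀ z, |b z| ≤ C) : Integrable (fun z => b z • F z) μ :=
  hF.bdd_smul C hb.aestronglyMeasurable (ae_of_all _ hb1)

/-- The density ratio `s` is at most 2, so integrability under `ω` passes to `ω'` and unbiasedness
applies there. -/
lemma tiltOrthogonal_of_unbiased {φ h : (YPath n Y × XPath n X) × A → E}
    (hφ : Integrable φ (M.law θ ω)) (hh : Integrable h (M.law θ ω))
    (hub : ∀ ω' : M.Nuisance, Integrable φ (M.law θ ω') → Integrable h (M.law θ ω') →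
      ∫ z, φ z ∂M.law θ ω' = ∫ z, h z ∂M.law θ ω') :
    TiltOrthogonal θ ω fun z => φ z - h z := by
  intro ω' s hs hs1 hd
  have hlaw := law_eq_withDensity hs hd
  have hbd : ∀ z, |s z| ≤ 2 := fun z => by rw [abs_of_nonneg (hs1 z).1]; exact (hs1 z).2
  have hφs := integrable_bdd_smul hφ hs hbd
  have hhs := integrable_bdd_smul hh hs hbd
  have hint : ∀ G : (YPath n Y × XPath n X) × A → E,
      Integrable (fun z => s z • G z) (M.law θ ω) → Integrable G (M.law θ ω') := fun G hG => by
    rw [hlaw, integrable_withDensity_iff_integrable_smul' (by fun_prop)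
      (ae_of_all _ fun _ => ENNReal.ofReal_lt_top)]
    simpa only [ENNReal.toReal_ofReal (hs1 _).1] using hG
  have heq : ∀ G : (YPath n Y × XPath n X) × A → E,
      ∫ z, G z ∂M.law θ ω' = ∫ z, s z • G z ∂M.law θ ω := fun G => by
    rw [hlaw, integral_withDensity_eq_integral_toReal_smul (by fun_prop)
      (ae_of_all _ fun _ => ENNReal.ofReal_lt_top)]
    simp only [ENNReal.toReal_ofReal (hs1 _).1]
  have := hub ω' (hint φ hφs) (hint h hhs)
  rw [heq, heq] at this
  simp only [smul_sub]
  rw [integral_sub hφs hhs, this, sub_self]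

lemma TiltOrthogonal.integral_eq_zero (hO : TiltOrthogonal θ ω F) :
    ∫ z, F z ∂M.law θ ω = 0 := by
  simpa using hO ω (fun _ => 1) measurable_const (fun _ => ⟨zero_le_one, one_le_two⟩) (by simp)

lemma TiltOrthogonal.integral_smul_eq (hO : TiltOrthogonal θ ω F)
    (hF : Integrable F (M.law θ ω)) {ω' : M.Nuisance} {b c : (YPath n Y × XPath n X) × A → ℝ}
    (hb : Measurable b) (hc : Measurable c) (hb1 : ∀ z, |b z| ≤ 1) (hc1 : ∀ z, |c z| ≤ 1)
    (hd : ∀ z, M.fullDensity θ ω' z = M.fullDensity θ ω z * (1 + (b z - c z) / 4)) :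
    ∫ z, b z • F z ∂M.law θ ω = ∫ z, c z • F z ∂M.law θ ω := by
  have h := hO ω' (fun z => 1 + (b z - c z) / 4) (by fun_prop) (fun z => by
    have h1 := abs_le.1 (hb1 z)
    have h2 := abs_le.1 (hc1 z)
    constructor <;> linarith [h1.1, h1.2, h2.1, h2.2]) hd
  have hbF := integrable_bdd_smul hF hb hb1
  have hcF := integrable_bdd_smul hF hc hc1
  have heq : ∀ z, (1 + (b z - c z) / 4) • F z
      = F z + (4 : ℝ)⁻¹ • (b z • F z - c z • F z) := fun z => by
    rw [← sub_smul, smul_smul, add_smul, one_smul]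
    congr 2
    ring
  simp only [heq] at h
  have hdF : Integrable (fun z => (4 : ℝ)⁻¹ • (b z • F z - c z • F z)) (M.law θ ω) :=
    (hbF.sub hcF).smul _
  rw [integral_add hF hdF, hO.integral_eq_zero, zero_add, integral_smul,
    integral_sub hbF hcF, smul_eq_zero] at h
  exact sub_eq_zero.1 (h.resolve_left (by norm_num))

/-- Tilting one feedback density by `β` multiplies the full density by 1 + (b − c)/4, where c is the
conditional mean of b given the history before that regressor. -/
lemma TiltOrthogonal.integral_feedback (hO : TiltOrthogonal θ ω F)
    (hF : Integrable F (M.law θ ω)) (j : Fin n)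
    {β : (Fin (j.val + 1 + 1) → Y) × (Fin (j.val + 1) → X) × A × X → ℝ}
    (hβ : Measurable β) (hβ1 : ∀ p, |β p| ≤ 1) {b : (YPath n Y × XPath n X) × A → ℝ}
    (hb : ∀ z, b z = β (yPast (j.val + 1) (by omega) z.1.1, xPast (j.val + 1) (by omega) z.1.2,
      z.2, z.1.2 j.succ)) :
    ∫ z, b z • F z ∂M.law θ ω
      = ∫ z, stepAvg (M.refX j.succ) (setX j.succ) (ω.gData j) b z • F z ∂M.law θ ω := by
  classical
  obtain ⟨D⟩ := nonempty_marginalDensities θ ω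
  have hbm : Measurable b := by
    rw [funext hb]
    exact hβ.comp (measurable_histData j)
  have hbset : ∀ z u, b (setX j.succ z u) = β (yPast (j.val + 1) (by omega) z.1.1,
      xPast (j.val + 1) (by omega) z.1.2, z.2, u) := fun z u => by
    rw [hb]
    have : xPast (j.val + 1) (by omega) (Function.update z.1.2 j.succ u)
        = xPast (j.val + 1) (by omega) z.1.2 := by
      funext i
      refine Function.update_of_ne (fun h => ?_) _ _
      have := congrArg Fin.val h
      simp only [Fin.val_succ] at this; omega
    simp [setX, this]
  have havg : ∀ z, stepAvg (M.refX j.succ) (setX j.succ) (ω.gData j) b z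
      = ∫ u, ω.g j (yPast (j.val + 1) (by omega) z.1.1) (xPast (j.val + 1) (by omega) z.1.2) z.2 u *
        β (yPast (j.val + 1) (by omega) z.1.1, xPast (j.val + 1) (by omega) z.1.2, z.2, u)
          ∂M.refX j.succ := fun z => by
    simp only [stepAvg, hbset, gData_setX, smul_eq_mul]
  have hgm : ∀ (ys : Fin (j.val + 1 + 1) → Y) (xs : Fin (j.val + 1) → X) (a : A),
      Measurable (ω.g j ys xs a) := fun ys xs a =>
    (ω.g_measurable j).comp (by fun_prop : Measurable fun u => (ys, xs, a, u))
  -- Tilting by the zero function is trivial, so only period `j` changes.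
  set B : (t : Fin n) → (Fin (t.val + 1 + 1) → Y) × (Fin (t.val + 1) → X) × A × X → ℝ :=
    Function.update (fun _ _ => 0) j β with hB
  have hBm : ∀ t, Measurable (B t) := fun t => by
    rcases eq_or_ne t j with rfl | h
    · simpa [hB] using hβ
    · simp [hB, h]
  have hB1 : ∀ t p, |B t p| ≤ 1 := fun t p => by
    rcases eq_or_ne t j with rfl | h
    · simpa [hB] using hβ1 p
    · simp [hB, h]
  refine hO.integral_smul_eq hF (ω' := ω.tiltG B hBm hB1) hbm
    ((isStep_feedback θ ω D j).stronglyMeasurable_avg hbm.stronglyMeasurable).measurable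
    (fun z => by rw [hb]; exact hβ1 _) (fun z => ?_) (fun z => ?_)
  · rw [havg]
    exact abs_integral_density_mul_le (hgm _ _ _) (fun u => (ω.g_pos _ _ _ _ _).le)
      (ω.g_lintegral _ _ _ _) (fun _ => hβ1 _)
  · have hfac : ∀ t : Fin n, (ω.tiltG B hBm hB1).gData t z = ω.gData t z *
        if t = j then 1 + (b z - stepAvg (M.refX j.succ) (setX j.succ) (ω.gData j) b z) / 4
          else 1 := fun t => by
      rcases eq_or_ne t j with rfl | h
      · rw [if_pos rfl, havg, hb]
        simp [Nuisance.gData, Nuisance.tiltG, tiltDensity, hB]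
      · rw [if_neg h]
        simp [Nuisance.gData, Nuisance.tiltG, tiltDensity, hB, h]
    have hprod : ∏ t, (ω.tiltG B hBm hB1).gData t z = (∏ t, ω.gData t z) *
        (1 + (b z - stepAvg (M.refX j.succ) (setX j.succ) (ω.gData j) b z) / 4) := by
      simp_rw [hfac]
      rw [Finset.prod_mul_distrib, Finset.prod_ite_eq' Finset.univ j]
      simp
    have e : ∀ ω' : M.Nuisance, M.fullDensity θ ω' z
      = (∏ t, M.fData θ t z) * (∏ t, ω'.gData t z) *
        ω'.pi (z.1.1 0) (z.1.2 0) z.2 * ω'.nu (z.1.1 0) (z.1.2 0) := fun _ => rfl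
    rw [e, e, hprod]
    simp only [Nuisance.tiltG]
    ring

/-- Tilting π replaces `β` by its mean over the latent variable, a function of (y_0, x_1); tilting ν
replaces that by a constant, and F has mean zero. -/
lemma TiltOrthogonal.integral_latent (hO : TiltOrthogonal θ ω F)
    (hF : Integrable F (M.law θ ω)) {β : Y × X × A → ℝ} (hβ : Measurable β)
    (hβ1 : ∀ p, |β p| ≤ 1) :
    ∫ z, β (z.1.1 0, z.1.2 0, z.2) • F z ∂M.law θ ω = 0 := by
  have hinit : ∀ {β : Y × X → ℝ}, Measurable β → (∀ p, |β p| ≤ 1) →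
      ∫ z, β (z.1.1 0, z.1.2 0) • F z ∂M.law θ ω = 0 := fun {β} hβ hβ1 => by
    have hnu : ∀ p : Y × X, 0 ≤ ω.nu p.1 p.2 := fun p => (ω.nu_pos _ _).le
    rw [hO.integral_smul_eq hF (ω' := ω.tiltNu β hβ hβ1)
      (c := fun _ => ∫ p, ω.nu p.1 p.2 * β p ∂(M.refY 0).prod (M.refX 0)) (by fun_prop)
      measurable_const (fun _ => hβ1 _)
      (fun _ => abs_integral_density_mul_le ω.nu_measurable hnu ω.nu_lintegral_prod hβ1)
      (fun z => by simp only [fullDensity, Nuisance.tiltNu, tiltDensity]; ring),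
      integral_smul, hO.integral_eq_zero, smul_zero]
  have hpm : ∀ y x, Measurable (ω.pi y x) := fun y x =>
    ω.pi_measurable.comp (by fun_prop : Measurable fun u => (y, x, u))
  set c : Y × X → ℝ := fun p => ∫ a, ω.pi p.1 p.2 a * β (p.1, p.2, a) ∂M.refA with hc
  have hcm : Measurable c := by
    have e : Measurable fun p : (Y × X) × A => (p.1.1, p.1.2, p.2) := by fun_prop
    exact (StronglyMeasurable.integral_prod_right
      (f := fun (p : Y × X) a => ω.pi p.1 p.2 a * β (p.1, p.2, a))
      ((ω.pi_measurable.comp e).mul (hβ.comp e)).stronglyMeasurable).measurable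
  have hc1 : ∀ p, |c p| ≤ 1 := fun p => abs_integral_density_mul_le (hpm _ _)
    (fun u => (ω.pi_pos _ _ _).le) (ω.pi_lintegral _ _) (fun _ => hβ1 _)
  rw [hO.integral_smul_eq hF (ω' := ω.tiltPi β hβ hβ1) (c := fun z => c (z.1.1 0, z.1.2 0))
    (by fun_prop) (by fun_prop) (fun _ => hβ1 _) (fun _ => hc1 _)
    (fun z => by simp only [fullDensity, Nuisance.tiltPi, tiltDensity, hc]; ring)]
  exact hinit hcm hc1

end Moments

end PanelModel

/-! ### Testing functions of the past, and part (B). -/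

lemma ae_eq_zero_of_forall_integral_indicator_smul {Z W E : Type*} [MeasurableSpace Z]
    [MeasurableSpace W] [NormedAddCommGroup E] [NormedSpace ℝ E] [CompleteSpace E]
    {P : Measure Z} {π : Z → W} {ι : W → Z} (hπ : Measurable π) (hι : Measurable ι) {D : Z → E}
    (hD : StronglyMeasurable D) (hi : Integrable D P) (hfac : ∀ z, D (ι (π z)) = D z)
    (h0 : ∀ s : Set W, MeasurableSet s → ∫ z, s.indicator (fun _ => (1 : ℝ)) (π z) • D z ∂P = 0) :
    D =ᵐ[P] 0 := by
  -- `D` factors through `π`, so it can be tested on the image measure, where indicators determine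
  -- an integrable function.
  have hcomp : (D ∘ ι) ∘ π = D := funext hfac
  have hsm : StronglyMeasurable (D ∘ ι) := hD.comp_measurable hι
  have hint : Integrable (D ∘ ι) (P.map π) := by
    rw [integrable_map_measure hsm.aestronglyMeasurable hπ.aemeasurable, hcomp]
    exact hi
  have hz : D ∘ ι =ᵐ[P.map π] 0 := by
    refine hint.ae_eq_zero_of_forall_setIntegral_eq_zero fun s hs _ => ?_
    rw [setIntegral_map hs hsm.aestronglyMeasurable hπ.aemeasurable,
      ← integral_indicator (hπ hs), ← h0 s hs]
    refine integral_congr_ae (ae_of_all _ fun z => ?_)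
    by_cases hzs : π z ∈ s
    · have : z ∈ π ⁻¹' s := hzs
      simp [Set.indicator_of_mem hzs, Set.indicator_of_mem this, hfac]
    · have : z ∉ π ⁻¹' s := hzs
      simp [Set.indicator_of_notMem hzs, Set.indicator_of_notMem this]
  filter_upwards [ae_of_ae_map hπ.aemeasurable hz] with z hz
  simpa [hfac] using hz

lemma abs_indicator_one_le {W : Type*} (s : Set W) (w : W) :
    |s.indicator (fun _ => (1 : ℝ)) w| ≤ 1 := by
  by_cases h : w ∈ s <;> simp [h]

namespace PanelModel

variable {n : ℕ} {Θ Y X A : Type*}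
  [MeasurableSpace Y] [MeasurableSpace X] [MeasurableSpace A]
  {M : PanelModel n Θ Y X A}

/-- Complete data with given past; the other coordinates are filled with copies. -/
def fillData (j : ℕ) (ys : Fin (j + 1 + 1) → Y) (xs : Fin (j + 1) → X) (a : A) (u : X) :
    (YPath n Y × XPath n X) × A :=
  ((fun i => if h : i.val < j + 1 + 1 then ys ⟨i, h⟩ else ys 0,
    fun i => if h : i.val < j + 1 then xs ⟨i, h⟩ else u), a)

lemma measurable_fillData (j : ℕ) :
    Measurable fun q : (Fin (j + 1 + 1) → Y) × (Fin (j + 1) → X) × A × X =>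
      (fillData j q.1 q.2.1 q.2.2.1 q.2.2.2 : (YPath n Y × XPath n X) × A) := by
  unfold fillData
  refine Measurable.prodMk (Measurable.prodMk ?_ ?_) (by fun_prop)
  · refine measurable_pi_iff.2 fun i => ?_
    split_ifs <;> fun_prop
  · refine measurable_pi_iff.2 fun i => ?_
    split_ifs <;> fun_prop

omit [MeasurableSpace Y] [MeasurableSpace X] [MeasurableSpace A] in
lemma agree_fillData (j : Fin n) (z : (YPath n Y × XPath n X) × A) (u : X) :
    Agree (j.val + 1) j.val (fillData j.val (yPast (j.val + 1) (by omega) z.1.1)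
      (xPast (j.val + 1) (by omega) z.1.2) z.2 u) z := by
  refine ⟨fun i hi => ?_, fun i hi => ?_, rfl⟩
  · simp only [fillData, yPast, dif_pos (Nat.lt_succ_of_le hi)]
  · simp only [fillData, xPast, dif_pos (Nat.lt_succ_of_le hi)]

omit [MeasurableSpace Y] [MeasurableSpace X] [MeasurableSpace A] in
lemma agree_fillData_succ (j : Fin n) (z : (YPath n Y × XPath n X) × A) :
    Agree (j.val + 1) (j.val + 1) (fillData j.val (yPast (j.val + 1) (by omega) z.1.1)
      (xPast (j.val + 1) (by omega) z.1.2) z.2 (z.1.2 j.succ)) z := by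
  refine ⟨(agree_fillData j z _).1, fun i hi => ?_, rfl⟩
  rcases hi.lt_or_eq with h | h
  · exact (agree_fillData j z _).2.1 i (Nat.lt_succ_iff.1 h)
  · have : i = j.succ := Fin.ext h
    subst this
    simp [fillData]

section Necessity

variable {E : Type*} [NormedAddCommGroup E] [NormedSpace ℝ E]

/-- `H` is a version of the conditional mean of `F` given the past `(y₀, …, y_j, x₁, …, x_{k+1})`
and `a`, and of the function `G`. -/
structure IsPastMean (θ : Θ) (ω : M.Nuisance) (D : M.MarginalDensities)
    (F G : (YPath n Y × XPath n X) × A → E) (j k : ℕ)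
    (H : (YPath n Y × XPath n X) × A → E) : Prop where
  stronglyMeasurable : StronglyMeasurable H
  dependsOnPast : DependsOnPast j k H
  integrable : Integrable H (stage θ ω D j k)
  ae_eq : G =ᵐ[stage θ ω D j k] H
  moment : ∀ b : (YPath n Y × XPath n X) × A → ℝ, Measurable b → (∀ z, |b z| ≤ 1) →
    DependsOnPast j k b → ∫ z, b z • F z ∂M.law θ ω = ∫ z, b z • H z ∂stage θ ω D j k

variable {θ : Θ} {ω : M.Nuisance} {D : M.MarginalDensities}
  {F : YPath n Y → XPath n X → A → E}

lemma stepAvg_smul_of_invariant {Z U : Type*} [MeasurableSpace U] {κ : Measure U} {T : Z → U → Z}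
    {q : Z → ℝ} {b : Z → ℝ} {H : Z → E} (hb : ∀ z u, b (T z u) = b z) (z : Z) :
    stepAvg κ T q (fun z => b z • H z) z = b z • stepAvg κ T q H z := by
  simp only [stepAvg, hb, smul_comm (q _) (b z)]
  exact integral_smul _ _

lemma stepAvg_smul_of_invariant' {Z U : Type*} [MeasurableSpace U] {κ : Measure U} {T : Z → U → Z}
    [CompleteSpace E] {q : Z → ℝ} {b : Z → ℝ} {H : Z → E} (hH : ∀ z u, H (T z u) = H z) (z : Z) :
    stepAvg κ T q (fun z => b z • H z) z = stepAvg κ T q b z • H z := by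
  simp only [stepAvg, hH, smul_smul]
  exact integral_smul_const _ _

lemma DependsOnPast.average_feedback {j : Fin n} {H : (YPath n Y × XPath n X) × A → E}
    (hH : DependsOnPast (j.val + 1) (j.val + 1) H) (ω : M.Nuisance) :
    DependsOnPast (j.val + 1) j.val
      (stepAvg (M.refX j.succ) (setX j.succ) (ω.gData j) H) := fun z z' h => by
  refine integral_congr_ae (ae_of_all _ fun u => ?_)
  have hag := Agree.setX (i := j.succ) (by simp) h u
  simp only [hH _ _ hag, dependsOnPast_gData ω j _ _ hag]

lemma IsPastMean.integrable_section (hF : StronglyMeasurable fun z :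
      (YPath n Y × XPath n X) × A => F z.1.1 z.1.2 z.2) {k : Fin (n + 1)}
    {N : (YPath n Y × XPath n X) × A → E}
    (hN : IsPastMean θ ω D (fun z => F z.1.1 z.1.2 z.2) (M.iterData θ F k.succ) (k.val + 1) k.val N) :
    ∀ᵐ z ∂stage θ ω D k.val k.val, Integrable (fun u => M.fData θ k (setY k.succ z u) •
      M.iterData θ F k.succ (setY k.succ z u)) (M.refY k.succ) :=
  (isStep_outcome θ ω D k).ae_integrable (stronglyMeasurable_iterData θ ω D hF _)
    (hN.integrable.congr hN.ae_eq.symm)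

/-- This is the tower property: a test function of the past ignores the redrawn outcome and comes
out of the average, which is by definition the next iterated integral. -/
lemma IsPastMean.average_outcome {k : Fin (n + 1)} {N : (YPath n Y × XPath n X) × A → E}
    (hN : IsPastMean θ ω D (fun z => F z.1.1 z.1.2 z.2) (M.iterData θ F k.succ) (k.val + 1) k.val N) :
    IsPastMean θ ω D (fun z => F z.1.1 z.1.2 z.2) (M.iterData θ F k.castSucc) k.val k.val
      (stepAvg (M.refY k.succ) (setY k.succ) (M.fData θ k) N) where
  stronglyMeasurable := (isStep_outcome θ ω D k).stronglyMeasurable_avg hN.stronglyMeasurable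
  dependsOnPast z z' h := by
    refine integral_congr_ae (ae_of_all _ fun u => ?_)
    have hag := Agree.setY (i := k.succ) (by simp) h u
    simp only [hN.dependsOnPast _ _ hag, dependsOnPast_fData θ k _ _ hag]
  integrable := (isStep_outcome θ ω D k).integrable_avg hN.stronglyMeasurable hN.integrable
  ae_eq := by
    rw [iterData_castSucc]
    filter_upwards [(isStep_outcome θ ω D k).avg_congr hN.ae_eq] with z hz
    exact integral_congr_ae hz
  moment b hb hb1 hbp := by
    rw [hN.moment b hb hb1 (hbp.mono (Nat.le_succ _) le_rfl),
      ← (isStep_outcome θ ω D k).integral_avg (H := fun z => b z • N z)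
        (hb.stronglyMeasurable.smul hN.stronglyMeasurable)
        (integrable_bdd_smul hN.integrable hb hb1)]
    refine integral_congr_ae (ae_of_all _ fun z => ?_)
    exact stepAvg_smul_of_invariant (fun z u => hbp.setY_eq (by simp) z u) z

variable [CompleteSpace E]

/-- The core of part (B). For a test function b with feedback average c, the tilt gives ∫ b H = ∫ c
H, and averaging over the regressor gives ∫ c H = ∫ c N = ∫ b N. Thus H − N is orthogonal to every
bounded function of its own arguments and vanishes. -/
lemma IsPastMean.average_feedback {j : Fin n} {F G : (YPath n Y × XPath n X) × A → E}
    {H : (YPath n Y × XPath n X) × A → E}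
    (hO : TiltOrthogonal θ ω F) (hF : Integrable F (M.law θ ω))
    (hH : IsPastMean θ ω D F G (j.val + 1) (j.val + 1) H) :
    G =ᵐ[stage θ ω D (j.val + 1) (j.val + 1)]
        stepAvg (M.refX j.succ) (setX j.succ) (ω.gData j) H ∧
      IsPastMean θ ω D F G (j.val + 1) j.val
        (stepAvg (M.refX j.succ) (setX j.succ) (ω.gData j) H) := by
  have hX := isStep_feedback θ ω D j
  have hone := lintegral_gData_setX ω j
  set N := stepAvg (M.refX j.succ) (setX j.succ) (ω.gData j) H with hNdef
  have hNsm : StronglyMeasurable N := hX.stronglyMeasurable_avg hH.stronglyMeasurable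
  have hNint : Integrable N (stage θ ω D (j.val + 1) j.val) :=
    hX.integrable_avg hH.stronglyMeasurable hH.integrable
  have hNdep : DependsOnPast (j.val + 1) j.val N := hH.dependsOnPast.average_feedback ω
  have hNinv : ∀ z u, N (setX j.succ z u) = N z := fun z u => hNdep.setX_eq (by simp) z u
  have hNint' : Integrable N (stage θ ω D (j.val + 1) (j.val + 1)) :=
    (hX.integrable_iff_of_invariant hone hNsm hNinv).2 hNint
  have hHN : (fun z => H z - N z) =ᵐ[stage θ ω D (j.val + 1) (j.val + 1)] 0 := by
    have hdep : DependsOnPast (j.val + 1) (j.val + 1) fun z => H z - N z := fun z z' h => by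
      simp only
      rw [hH.dependsOnPast _ _ h, hNdep _ _ (h.mono le_rfl (Nat.le_succ _))]
    refine ae_eq_zero_of_forall_integral_indicator_smul (measurable_histData j)
      (measurable_fillData j.val) (hH.stronglyMeasurable.sub hNsm) (hH.integrable.sub hNint')
      (fun z => hdep _ _ (agree_fillData_succ j z)) fun s hs => ?_
    set β : (Fin (j.val + 1 + 1) → Y) × (Fin (j.val + 1) → X) × A × X → ℝ :=
      s.indicator fun _ => 1 with hβdef
    have hβ : Measurable β := measurable_const.indicator hs
    have hβ1 : ∀ p, |β p| ≤ 1 := abs_indicator_one_le s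
    set b : (YPath n Y × XPath n X) × A → ℝ := fun z => β (yPast (j.val + 1) (by omega) z.1.1,
      xPast (j.val + 1) (by omega) z.1.2, z.2, z.1.2 j.succ) with hb
    have hbm : Measurable b := hβ.comp (measurable_histData j)
    have hb1 : ∀ z, |b z| ≤ 1 := fun z => hβ1 _
    have hbdep : DependsOnPast (j.val + 1) (j.val + 1) b := fun z z' h => by
      simp only [hb]
      rw [h.2.1 j.succ (by simp), h.2.2,
        show yPast (j.val + 1) (by omega) z.1.1 = yPast (j.val + 1) (by omega) z'.1.1 from
          funext fun i => h.1 _ (by simp only; omega),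
        show xPast (j.val + 1) (by omega) z.1.2 = xPast (j.val + 1) (by omega) z'.1.2 from
          funext fun i => h.2.1 _ (by simp only; omega)]
    set c := stepAvg (M.refX j.succ) (setX j.succ) (ω.gData j) b with hc
    have hcm : Measurable c := (hX.stronglyMeasurable_avg hbm.stronglyMeasurable).measurable
    have hcdep : DependsOnPast (j.val + 1) j.val c := hbdep.average_feedback ω
    have hcinv : ∀ z u, c (setX j.succ z u) = c z := fun z u => hcdep.setX_eq (by simp) z u
    have hc1 : ∀ z, |c z| ≤ 1 := fun z => by
      simp only [hc, stepAvg, smul_eq_mul]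
      have hset : Measurable fun u => setX j.succ z u :=
        hX.measurable_map.comp measurable_prodMk_left
      exact abs_integral_density_mul_le ((measurable_gData ω j).comp hset)
        (fun u => (gData_pos ω j _).le) (hone z) (fun u => hb1 _)
    have e1 : ∫ z, b z • H z ∂stage θ ω D (j.val + 1) (j.val + 1)
        = ∫ z, c z • H z ∂stage θ ω D (j.val + 1) (j.val + 1) := by
      rw [← hH.moment b hbm hb1 hbdep,
        ← hH.moment c hcm hc1 (hcdep.mono le_rfl (Nat.le_succ _))]
      exact hO.integral_feedback hF j hβ hβ1 (fun _ => rfl)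
    have e2 : ∫ z, c z • H z ∂stage θ ω D (j.val + 1) (j.val + 1)
        = ∫ z, b z • N z ∂stage θ ω D (j.val + 1) (j.val + 1) := by
      rw [← hX.integral_avg (H := fun z => c z • H z)
          (hcm.stronglyMeasurable.smul hH.stronglyMeasurable)
          (integrable_bdd_smul hH.integrable hcm hc1),
        ← hX.integral_avg (H := fun z => b z • N z)
        (hbm.stronglyMeasurable.smul hNsm)
          (integrable_bdd_smul hNint' hbm hb1)]
      refine integral_congr_ae (ae_of_all _ fun z => ?_)
      exact (stepAvg_smul_of_invariant hcinv z).trans (stepAvg_smul_of_invariant' hNinv z).symm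
    have e3 : ∫ z, b z • (H z - N z) ∂stage θ ω D (j.val + 1) (j.val + 1) = 0 := by
      simp only [smul_sub]
      rw [integral_sub (integrable_bdd_smul hH.integrable hbm hb1)
        (integrable_bdd_smul hNint' hbm hb1), e1, e2, sub_self]
    exact e3
  have hGN : G =ᵐ[stage θ ω D (j.val + 1) (j.val + 1)] N := by
    filter_upwards [hHN, hH.ae_eq] with z h1 h2
    rw [h2]
    exact sub_eq_zero.1 h1
  refine ⟨hGN, hNsm, hNdep, hNint, ?_, fun b hb hb1 hbp => ?_⟩
  -- The identity now loses the last feedback factor: the smaller stage has the same null sets.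
  · exact (ae_stage_iff θ ω D _ _).2 ((ae_stage_iff θ ω D _ _).1 hGN)
  · rw [hH.moment b hb hb1 (hbp.mono le_rfl (Nat.le_succ _)),
      ← hX.integral_avg (H := fun z => b z • H z)
        (hb.stronglyMeasurable.smul hH.stronglyMeasurable)
        (integrable_bdd_smul hH.integrable hb hb1)]
    refine integral_congr_ae (ae_of_all _ fun z => ?_)
    exact stepAvg_smul_of_invariant (fun z u => hbp.setX_eq (by simp) z u) z

lemma TiltOrthogonal.exists_isPastMean
    (hF : StronglyMeasurable fun z : (YPath n Y × XPath n X) × A => F z.1.1 z.1.2 z.2)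
    (hO : TiltOrthogonal θ ω fun z => F z.1.1 z.1.2 z.2)
    (hi : Integrable (fun z => F z.1.1 z.1.2 z.2) (M.law θ ω)) (D : M.MarginalDensities)
    (k : Fin (n + 1)) :
    ∃ N, IsPastMean θ ω D (fun z => F z.1.1 z.1.2 z.2) (M.iterData θ F k.succ)
      (k.val + 1) k.val N := by
  induction k using Fin.reverseInduction with
  | last =>
    refine ⟨fun z => F z.1.1 z.1.2 z.2, hF, fun z z' h => ?_, ?_, ?_, ?_⟩
    · have hy : z.1.1 = z'.1.1 := funext fun i => h.1 i (by simp only [Fin.val_last]; omega)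
      have hx : z.1.2 = z'.1.2 := funext fun i => h.2.1 i (by simp only [Fin.val_last]; omega)
      rw [hy, hx, h.2.2]
    · rw [Fin.val_last, stage_last]; exact hi
    · rw [Fin.succ_last, iterData_last]
    · intro b _ _ _
      rw [Fin.val_last, stage_last]
  | cast j ih =>
    obtain ⟨N, hN⟩ := ih
    exact ⟨_, (hN.average_outcome.average_feedback hO hi).2⟩

variable [MeasurableSpace E] [BorelSpace E]

/-- A function whose mean vanishes under all reweightings satisfies the restrictions. -/
theorem TiltOrthogonal.restrictions
    (hF : StronglyMeasurable fun z : (YPath n Y × XPath n X) × A => F z.1.1 z.1.2 z.2)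
    (hO : TiltOrthogonal θ ω fun z => F z.1.1 z.1.2 z.2)
    (hi : Integrable (fun z => F z.1.1 z.1.2 z.2) (M.law θ ω)) : M.Restrictions θ F := by
  obtain ⟨D⟩ := nonempty_marginalDensities θ ω
  have hex := hO.exists_isPastMean hF hi D
  refine ⟨fun t => ?_, ?_, fun t => ?_⟩
  · obtain ⟨N, hN⟩ := hex t
    have := (ae_stage_iff θ ω D _ _).1 (hN.integrable_section hF)
    filter_upwards [this] with z hz hat
    have := hz hat
    simp only [fData_setY] at this
    exact this
  · obtain ⟨N, hN⟩ := hex 0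
    have hH := hN.average_outcome
    set H := stepAvg (M.refY (Fin.succ 0)) (setY (Fin.succ 0)) (M.fData θ 0) N
    have hπ : Measurable fun z : (YPath n Y × XPath n X) × A => (z.1.1 0, z.1.2 0, z.2) := by
      fun_prop
    have hH0 : H =ᵐ[stage θ ω D 0 0] 0 := by
      refine ae_eq_zero_of_forall_integral_indicator_smul hπ
        -- Constant paths serve as representatives, since `H` sees only the coordinates of index 0.
        (ι := fun p => ((fun _ => p.1, fun _ => p.2.1), p.2.2)) (by fun_prop)
        hH.stronglyMeasurable hH.integrable (fun z => hH.dependsOnPast _ _ ?_) fun s hs => ?_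
      · refine ⟨fun i hi => ?_, fun i hi => ?_, rfl⟩
        · rw [show i = 0 from Fin.ext (by simpa using hi)]
        · rw [show i = 0 from Fin.ext (by simpa using hi)]
      · have hβ : Measurable (s.indicator fun _ => (1 : ℝ)) := measurable_const.indicator hs
        rw [← hO.integral_latent hi hβ (abs_indicator_one_le s)]
        refine (hH.moment _ (hβ.comp hπ) (fun _ => abs_indicator_one_le s _)
          fun z z' h => ?_).symm
        simp only [Function.comp_apply]
        rw [h.1 0 (by simp), h.2.1 0 (by simp), h.2.2]
    have hG0 := hH.ae_eq.trans hH0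
    filter_upwards [(ae_stage_iff θ ω D _ _).1 hG0] with z hz
    -- Attainability of the initial history is an empty condition.
    exact hz fun r hr => absurd hr (by simp)
  · obtain ⟨N, hN⟩ := hex t.succ
    obtain ⟨hae, hN'⟩ := hN.average_outcome.average_feedback (j := t) hO hi
    set N' := stepAvg (M.refX t.succ) (setX t.succ) (ω.gData t)
      (stepAvg (M.refY t.succ.succ) (setY t.succ.succ) (M.fData θ t.succ) N)
    -- Later regressors do not affect `N'`; `xs 0` is merely an available value to fill them with.
    refine ⟨fun ys xs a => N' (fillData t.val ys xs a (xs 0)), ?_, ?_⟩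
    · exact hN'.stronglyMeasurable.measurable.comp ((measurable_fillData t.val).comp
        (by fun_prop : Measurable fun q : (Fin (t.val + 1 + 1) → Y) × (Fin (t.val + 1) → X) × A =>
          (q.1, q.2.1, q.2.2, q.2.1 0)))
    · filter_upwards [(ae_stage_iff θ ω D _ _).1 hae] with z hz hat
      exact (hz hat).trans (hN'.dependsOnPast _ _ (agree_fillData t z _)).symm

end Necessity

end PanelModel

end

theorem theorem2 {n L : ℕ} {Θ Y X A : Type*}
    [MeasurableSpace Y] [MeasurableSpace X] [MeasurableSpace A]
    (M : PanelModel n Θ Y X A) [TopologicalSpace M.Nuisance] (θ : Θ)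
    (φ : Θ → YPath n Y → XPath n X → EuclideanSpace ℝ (Fin L))
    (h : Θ → YPath n Y → XPath n X → A → EuclideanSpace ℝ (Fin L))
    (hφ : Measurable (fun w : YPath n Y × XPath n X => φ θ w.1 w.2))
    (hh : Measurable (fun z : (YPath n Y × XPath n X) × A => h θ z.1.1 z.1.2 z.2)) :
    -- Part (A)
    (M.Restrictions θ (fun y x a => φ θ y x - h θ y x a) →
      ∀ ω : M.Nuisance,
        Integrable (fun z => φ θ z.1.1 z.1.2) (M.law θ ω) →
        Integrable (fun z => h θ z.1.1 z.1.2 z.2) (M.law θ ω) →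
        ∫ z, φ θ z.1.1 z.1.2 ∂(M.law θ ω) = M.avgEffect (h θ) θ ω) ∧
    -- Part (B)
    (∀ ωs : M.Nuisance,
      M.RootLikelihoodQMD θ ωs →
      (∃ N ∈ 𝓝 ωs,
        (⨆ ω ∈ N, ∫⁻ z, ‖φ θ z.1.1 z.1.2‖ₑ ^ 2 ∂(M.law θ ω)) < ⊤ ∧
        (⨆ ω ∈ N, ∫⁻ z, ‖h θ z.1.1 z.1.2 z.2‖ₑ ^ 2 ∂(M.law θ ω)) < ⊤) →
      (∀ ω : M.Nuisance,
        Integrable (fun z => φ θ z.1.1 z.1.2) (M.law θ ω) →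
        Integrable (fun z => h θ z.1.1 z.1.2 z.2) (M.law θ ω) →
        ∫ z, φ θ z.1.1 z.1.2 ∂(M.law θ ω) = M.avgEffect (h θ) θ ω) →
      M.Restrictions θ (fun y x a => φ θ y x - h θ y x a)) := by
  have hφz : Measurable fun z : (YPath n Y × XPath n X) × A => φ θ z.1.1 z.1.2 :=
    hφ.comp measurable_fst
  have hF : StronglyMeasurable fun z : (YPath n Y × XPath n X) × A =>
      φ θ z.1.1 z.1.2 - h θ z.1.1 z.1.2 z.2 := (hφz.sub hh).stronglyMeasurable
  refine ⟨fun hR ω hiφ hih => ?_, fun ωs _ hN hub => ?_⟩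
  · have := hR.integral_eq_zero hF (hiφ.sub hih)
    rw [integral_sub hiφ hih] at this
    exact sub_eq_zero.1 this
  · obtain ⟨N, hN, hbφ, hbh⟩ := hN
    have hL2 : ∀ G : (YPath n Y × XPath n X) × A → EuclideanSpace ℝ (Fin L), Measurable G →
        (⨆ ω ∈ N, ∫⁻ z, ‖G z‖ₑ ^ 2 ∂(M.law θ ω)) < ⊤ → Integrable G (M.law θ ωs) :=
      fun G hG hb => by
        -- A neighborhood contains its centre, so the supremum bounds the second moment at `ωs`.
        have hlt := (le_iSup₂ (f := fun ω (_ : ω ∈ N) => ∫⁻ z, ‖G z‖ₑ ^ 2 ∂(M.law θ ω)) ωs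
          (mem_of_mem_nhds hN)).trans_lt hb
        have hmem : MemLp G 2 (M.law θ ωs) := by
          refine ⟨hG.aestronglyMeasurable, ?_⟩
          rw [eLpNorm_lt_top_iff_lintegral_rpow_enorm_lt_top two_ne_zero ENNReal.ofNat_ne_top]
          simpa using hlt
        exact hmem.integrable one_le_two
    have hiφ := hL2 _ hφz hbφ
    have hih := hL2 _ hh hbh
    exact (PanelModel.tiltOrthogonal_of_unbiased hiφ hih hub).restrictions hF (hiφ.sub hih)
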